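/- Let $e[t]=\exp(2\pi i t)$ and let $\mathbb T=\mathbb R/\mathbb Z$. For $\omega\in\mathbb T$ let $T_\omega:\mathbb T^2\to\mathbb T^2$, $T_\omega(x,y)=(x+y,\,y+\omega)$, be the skew-shift, so that the first component of its $j$-th iterate is $(T_\omega^j(x,y))_1=\binom j2\omega+jy+x$. For $M,N$ and $\underline x,\underline y,\underline\omega\in\mathbb T^M$ let $X$ be the $M\times N$ matrix with entries $$X_{i,j}=N^{-1/2}\,e\big[(T_{\omega_i}^j(x_i,y_i))_1\big],\qquad 1\le i\le M,\ 1\le j\le N,$$ and let $$H_{M,N}=\begin{pmatrix}0&X\\X^*&0\end{pmatrix},\qquad \mu^{(2k)}_{M,N}=\frac1{2N}\operatorname{Tr}\big[H_{M,N}^{2k}\big].$$ Let $\mathbb E_{\underline y}[f]=\int_{[0,1]^M}f(y_1,\dots,y_M)\,dy_1\cdots dy_M$. For $\delta,\rho>0$, a sequence $(\omega_1,\omega_2,\dots)$ in $[0,1]$ is called $(\delta,\rho)$-quasi-random if there is a constant $C>0$ such that for all $N\ge1$ $$\Bigg|\frac1{N^5}\sum_{i_1,i_2=1}^{\lfloor\rho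 N\rfloor}\ \sum_{\substack{j_1,j_2,j_3,j_4=1\\ j_1+j_3=j_2+j_4}}^{N}e\Big[\frac{\omega_{i_1}-\omega_{i_2}}2\,(j_1^2-j_2^2+j_3^2-j_4^2)\Big]\Bigg|\le C\,N^{-\delta}.$$ For $r>0$ let $$f^{MP}_r(t)=\frac{\sqrt{(\lambda_+-t)(t-\lambda_-)}}{2\pi t r}\,\mathbf 1_{\lambda_-\le t\le\lambda_+},\qquad \lambda_\pm=(1\pm\sqrt r)^2,$$ be the density of the Marchenko–Pastur law with parameter $r$. For $\rho>0$ let $\mu_k=\int_{\mathbb R}t^k f(t)\,dt$ be the $k$-th moment of the rescaled density $f(t)=\rho^{-1}f^{MP}_{\rho^{-1}}(t/\rho)$. **Theorem.** Let $\rho>0$, $\delta>0$, let $(\omega_1,\omega_2,\dots)$ be $(\delta,\rho)$-quasi-random, let $k\ge1$, and set $M=\lfloor\rho N\rfloor$. Then, as $N\to\infty$, $$\mathbb E_{\underline y}\big[\mu^{(2k)}_{M,N}\big]=\mu_k+O\big(N^{-\delta/16}\big),$$ uniformly in the choice of the phases $(x_1,x_2,\dots)$; that is, there is a constant $C$ (depending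 on $\rho,\delta,k$ and the sequence of frequencies, but on neither $N$ nor the $x_i$) such that $\big|\mathbb E_{\underline y}[\mu^{(2k)}_{M,N}]-\mu_k\big|\le C N^{-\delta/16}$ for all $N\ge1$ and all phases $x_i\in\mathbb T$. -/

import Mathlib

noncomputable section

/-- The skew-shift with frequency `ω` on the two-dimensional torus `𝕋² = (ℝ/ℤ)²`:
`T (x, y) = (x + y, y + ω)`. -/
def skewShift (ω : UnitAddCircle) (p : UnitAddCircle × UnitAddCircle) :
    UnitAddCircle × UnitAddCircle :=
  (p.1 + p.2, p.2 + ω)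

/-- The exponential `e[t] = exp (2 π i t)` for real `t`. -/
def expe (t : ℝ) : ℂ := Complex.exp (2 * Real.pi * Complex.I * t)

/-- The exponential `e[t] = exp (2 π i t)` for `t` in the torus `ℝ/ℤ`. -/
def expTorus (t : UnitAddCircle) : ℂ := (AddCircle.toCircle t : ℂ)

theorem expTorus_coe (t : ℝ) : expTorus (t : UnitAddCircle) = expe t := by
  rw [expTorus, expe, AddCircle.toCircle_apply_mk, Circle.coe_exp]
  congr 1
  push_cast
  ring

/-- The first component of the `j`-th iterate of the skew-shift is `(j choose 2) ω + j y + x`. -/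
theorem skewShift_iterate (ω x y : UnitAddCircle) (j : ℕ) :
    (skewShift ω)^[j] (x, y) = (j.choose 2 • ω + j • y + x, y + j • ω) := by
  induction j with
  | zero => simp
  | succ n ih =>
    rw [Function.iterate_succ_apply', ih, skewShift, Nat.choose_succ_succ' n 1, Nat.choose_one_right]
    ext
    · simp only [add_smul, one_smul]; abel
    · simp only [add_smul, one_smul]; abel

/-- The `M × N` matrix `X` with entries `X_{i,j} = N^{-1/2} e[(T_i^j (x_i, y_i))_1]`, where `T_i` is
the skew-shift with frequency `ω_i`. The row index `i : Fin M` and the column index `j : Fin N` are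
counted from `0`, so the column with index `j` is the `(j+1)`-st one and carries the iterate
`T_i^(j+1)`. -/
def skewShiftX {M : ℕ} (N : ℕ) (ω x y : Fin M → UnitAddCircle) : Matrix (Fin M) (Fin N) ℂ :=
  fun i j =>
    (((Real.sqrt (N : ℝ))⁻¹ : ℝ) : ℂ) *
      expTorus ((skewShift (ω i))^[(j : ℕ) + 1] (x i, y i)).1

/-- The Hermitian `(M + N) × (M + N)` matrix `H_{M,N}` with off-diagonal blocks `X` and `X^*`. -/
def skewShiftH {M : ℕ} (N : ℕ) (ω x y : Fin M → UnitAddCircle) :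
    Matrix (Fin M ⊕ Fin N) (Fin M ⊕ Fin N) ℂ :=
  Matrix.fromBlocks 0 (skewShiftX N ω x y) (skewShiftX N ω x y).conjTranspose 0

/-- The normalized even moment `μ^(2k)_{M,N} = (2N)⁻¹ Tr (H_{M,N}^(2k))`. -/
def evenMoment {M : ℕ} (N k : ℕ) (ω x y : Fin M → UnitAddCircle) : ℂ :=
  (1 / (2 * (N : ℂ))) * Matrix.trace (skewShiftH N ω x y ^ (2 * k))

/-- The average of `f` over `y = (y_1, …, y_M)`, uniformly distributed in `[0,1]^M`. -/
def averageY {M : ℕ} (f : (Fin M → ℝ) → ℂ) : ℂ :=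
  ∫ y in Set.Icc (0 : Fin M → ℝ) 1, f y

/-- The average over `y` of the normalized even moment of `H_{M,N}`, for the first `M` terms of
the sequences of frequencies `ω` and of phases `x` (indexed from `0`). -/
def averagedEvenMoment (M N k : ℕ) (ω : ℕ → ℝ) (x : ℕ → UnitAddCircle) : ℂ :=
  averageY (M := M) fun y =>
    evenMoment N k (fun i => (ω i : UnitAddCircle)) (fun i => x i)
      (fun i => (y i : UnitAddCircle))

/-- The exponential sum
`N⁻⁵ ∑_{i₁,i₂ ≤ ⌊ρN⌋} ∑_{j₁+j₃=j₂+j₄} e[(ω_{i₁} - ω_{i₂})/2 * (j₁² - j₂² + j₃² - j₄²)]`,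
with `j₁, j₂, j₃, j₄` in `{1, …, N}`. The sequence is indexed from `0`, so that the first `⌊ρN⌋`
frequencies are those with index in `Finset.range ⌊ρN⌋`. -/
def expSumES (ρ : ℝ) (ω : ℕ → ℝ) (N : ℕ) : ℂ :=
  (1 / (N : ℂ) ^ 5) *
    ∑ i₁ ∈ Finset.range ⌊ρ * N⌋₊, ∑ i₂ ∈ Finset.range ⌊ρ * N⌋₊,
      ∑ j₁ ∈ Finset.Icc 1 N, ∑ j₂ ∈ Finset.Icc 1 N, ∑ j₃ ∈ Finset.Icc 1 N, ∑ j₄ ∈ Finset.Icc 1 N,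
        if j₁ + j₃ = j₂ + j₄ then
          expe ((ω i₁ - ω i₂) / 2 *
            ((j₁ : ℝ) ^ 2 - (j₂ : ℝ) ^ 2 + (j₃ : ℝ) ^ 2 - (j₄ : ℝ) ^ 2))
        else 0

/-- A sequence of frequencies in `[0,1]` is `(δ, ρ)`-quasi-random if the exponential sum is bounded
by a constant times `N^(-δ)`, for all `N ≥ 1`. -/
def QuasiRandom (δ ρ : ℝ) (ω : ℕ → ℝ) : Prop :=
  (∀ i, ω i ∈ Set.Icc (0 : ℝ) 1) ∧
    ∃ C : ℝ, 0 < C ∧ ∀ N : ℕ, 1 ≤ N → ‖expSumES ρ ω N‖ ≤ C * (N : ℝ) ^ (-δ)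

/-- The density of the Marchenko-Pastur law with parameter `r`. -/
def marchenkoPasturDensity (r t : ℝ) : ℝ :=
  (Set.Icc ((1 - Real.sqrt r) ^ 2) ((1 + Real.sqrt r) ^ 2)).indicator
    (fun s => Real.sqrt (((1 + Real.sqrt r) ^ 2 - s) * (s - (1 - Real.sqrt r) ^ 2)) /
      (2 * Real.pi * s * r)) t

/-- The density of the rescaled Marchenko-Pastur law: the image under `t ↦ ρ t` of the
Marchenko-Pastur law with parameter `ρ⁻¹`. -/
def rescaledMPDensity (ρ t : ℝ) : ℝ :=
  ρ⁻¹ * marchenkoPasturDensity ρ⁻¹ (t / ρ)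

/-- The `k`-th moment `μ_k` of the rescaled Marchenko-Pastur law. -/
def rescaledMPMoment (ρ : ℝ) (k : ℕ) : ℝ :=
  ∫ t : ℝ, t ^ k * rescaledMPDensity ρ t

end

/-! Expanding the trace of `(X X*)^k` gives a sum over closed paths of row labels whose edges carry
column indices `j`. The phases `x` telescope around the path, which gives uniformity in them.
Averaging over `y` keeps exactly the `j` that form a circulation: at each label, inflow equals
outflow. There remains the phase pairing each frequency with the divergence of `j (j - 1) / 2` at
its label.

If the word of row labels is noncrossing, conservation of `j` forces conservation of every function
of `j` (`pathDiv_comp_of_noncrossing`). So the phase is 1, and the number of circulations is an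
exact power of `N` (`closedSum_of_noncrossing`); the frequencies play no role. Counting such words
is a transfer problem: when letters are added one at a time, only the height `h` of the stack of
open blocks matters. With `s² = 1/ρ`, the transfer operator multiplies the functions `Im (e^{iθ} (1
+ s e^{iθ})^h)` by `ρ |1 + s e^{iθ}|²`, and `|1 + s e^{iθ}|²` parametrizes the support of the
Marchenko-Pastur law. This yields `μ_k` up to `O(1/N)` (`noncrossingSum_asymptotics`,
`transfer_iterate_one_zero`).

A crossing word contains a pattern `a b a b`. The stretches from `a` to `a` and from `b` to `b` are
overlapping cycles `u`, `w`, and the circulation may be shifted by `s u + t w`. As the phase is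
quadratic in `j`, the coefficient of the frequency of `a` acquires the mixed term `-s t`. Two
applications of Cauchy-Schwarz remove everything else and leave the quasi-randomness sum
(`sum_freqSum_sq_pow_four_le`), with a saving `N^(-δ/4)` in mean square and `N^(-δ/8)` in mean.
Distinct blocks must carry distinct labels; discarding coincidences costs `1/N`, which is
`O(N^(-δ))` because the diagonal of the quasi-randomness sum is already that large
(`QuasiRandom.exists_inv_le`). All errors fit into `N^(-δ/16)`. -/

open Finset

/-! ### Noncrossing words and the stack of open blocks. -/

section Noncrossing

variable {α β : Type*} [DecidableEq α] [DecidableEq β]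

/-- The labels of the blocks of a word that can still be continued without creating a crossing when
the word is read from right to left, the most recently used one first. -/
def openStack : List α → List α
  | [] => []
  | a :: w => if a ∈ w then (openStack w).dropWhile (fun b => decide (b ≠ a)) else a :: openStack w

/-- A word is noncrossing if each letter is either new or on the stack of open blocks. -/
def NoncrossingWord : List α → Prop
  | [] => True
  | a :: w => NoncrossingWord w ∧ (a ∈ w → a ∈ openStack w)

theorem openStack_sublist (w : List α) : (openStack w).Sublist w := by
  induction w with
  | nil => simp [openStack]
  | cons a w ih =>
    rw [openStack]
    split_ifs with h
    · exact ((List.dropWhile_sublist _).trans ih).trans (List.sublist_cons_self a w)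
    · exact ih.cons_cons a

theorem exists_dropWhile_eq (s : List α) (a : α) (ha : a ∈ s) :
    ∃ pre rest, s = pre ++ a :: rest ∧ a ∉ pre ∧
      s.dropWhile (fun b => decide (b ≠ a)) = a :: rest := by
  induction s with
  | nil => simp at ha
  | cons b s ih =>
    by_cases hb : b = a
    · subst hb
      exact ⟨[], s, by simp⟩
    · obtain ⟨pre, rest, h1, h2, h3⟩ := ih (by simpa [Ne.symm hb] using ha)
      refine ⟨b :: pre, rest, by simp [h1], by simp [h2, Ne.symm hb], ?_⟩
      rw [List.dropWhile_cons_of_pos (by simpa using hb), h3]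

theorem openStack_cons_of_mem {a : α} {w : List α} (h : a ∈ w) (hs : a ∈ openStack w) :
    ∃ pre rest, openStack w = pre ++ a :: rest ∧ a ∉ pre ∧ openStack (a :: w) = a :: rest := by
  obtain ⟨pre, rest, h1, h2, h3⟩ := exists_dropWhile_eq _ _ hs
  exact ⟨pre, rest, h1, h2, by rw [openStack, if_pos h, h3]⟩

theorem openStack_cons_of_notMem {a : α} {w : List α} (h : a ∉ w) :
    openStack (a :: w) = a :: openStack w := by
  rw [openStack, if_neg h]

theorem openStack_nodup (w : List α) : (openStack w).Nodup := by
  induction w with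
  | nil => simp [openStack]
  | cons a w ih =>
    rw [openStack]
    split_ifs with h
    · exact ih.sublist (List.dropWhile_sublist _)
    · exact List.nodup_cons.2 ⟨fun h' => h ((openStack_sublist w).subset h'), ih⟩

theorem exists_openStack_cons (a : α) (w : List α) (h : NoncrossingWord (a :: w)) :
    ∃ rest, openStack (a :: w) = a :: rest := by
  by_cases ha : a ∈ w
  · obtain ⟨_, rest, -, -, h3⟩ := openStack_cons_of_mem ha (h.2 ha)
    exact ⟨rest, h3⟩
  · exact ⟨_, openStack_cons_of_notMem ha⟩

/-- The bottom of the stack is the letter read first; reusing a letter removes only what lies above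
it. -/
theorem openStack_getLast? (w : List α) (h : NoncrossingWord w) :
    (openStack w).getLast? = w.getLast? := by
  induction w with
  | nil => rfl
  | cons a w ih =>
    have ih := ih h.1
    by_cases ha : a ∈ w
    · obtain ⟨pre, rest, h1, -, h3⟩ := openStack_cons_of_mem ha (h.2 ha)
      rw [h3]
      rw [h1] at ih
      obtain ⟨b, w, rfl⟩ := List.exists_cons_of_ne_nil (List.ne_nil_of_mem ha)
      rw [List.getLast?_cons_cons, ← ih, List.getLast?_append]
      simp [List.getLast?_cons]
    · rw [openStack_cons_of_notMem ha, List.getLast?_cons, List.getLast?_cons, ih]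

/-- A letter `a` leaves the stack only when some `b` below it is read again. The stack is a sublist
of the word, so `a, b` already occur in this order, and the new `b` stands in front. -/
theorem exists_sublist_of_notMem_openStack (w : List α) (hw : NoncrossingWord w) (a : α)
    (ha : a ∈ w) (hs : a ∉ openStack w) : ∃ b, b ≠ a ∧ [b, a, b].Sublist w := by
  induction w with
  | nil => simp at ha
  | cons c w ih =>
    have hc : a ≠ c := by
      rintro rfl
      obtain ⟨rest, h⟩ := exists_openStack_cons _ _ hw
      exact hs (by simp [h])
    have haw : a ∈ w := by simpa [hc] using ha
    by_cases has : a ∈ openStack w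
    · by_cases hcw : c ∈ w
      · obtain ⟨pre, rest, h1, -, h3⟩ := openStack_cons_of_mem hcw (hw.2 hcw)
        refine ⟨c, hc.symm, List.Sublist.cons_cons c ?_⟩
        have hpre : a ∈ pre := by
          rw [h1] at has
          rw [h3] at hs
          simp only [List.mem_append] at has
          exact has.resolve_right hs
        refine List.Sublist.trans ?_ (openStack_sublist w)
        rw [h1]
        exact (List.singleton_sublist.2 hpre).append (List.singleton_sublist.2 (by simp))
      · rw [openStack_cons_of_notMem hcw] at hs
        exact absurd (List.mem_cons_of_mem _ has) hs
    · obtain ⟨b, hb, h⟩ := ih hw.1 haw has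
      exact ⟨b, hb, h.cons c⟩

theorem exists_sublist_of_not_noncrossingWord (w : List α) (hw : ¬ NoncrossingWord w) :
    ∃ a b, a ≠ b ∧ [a, b, a, b].Sublist w := by
  induction w with
  | nil => simp [NoncrossingWord] at hw
  | cons a w ih =>
    by_cases h : NoncrossingWord w
    · have : a ∈ w ∧ a ∉ openStack w := by
        simpa [NoncrossingWord, h] using hw
      obtain ⟨b, hb, hs⟩ := exists_sublist_of_notMem_openStack w h a this.1 this.2
      exact ⟨a, b, hb.symm, hs.cons_cons a⟩
    · obtain ⟨x, y, hxy, hs⟩ := ih h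
      exact ⟨x, y, hxy, hs.cons a⟩

theorem exists_crossing {n : ℕ} (c : Fin n → α) (hc : ¬ NoncrossingWord (List.ofFn c)) :
    ∃ p₁ p₂ p₃ p₄ : Fin n, p₁ < p₂ ∧ p₂ < p₃ ∧ p₃ < p₄ ∧ c p₁ = c p₃ ∧ c p₂ = c p₄ ∧
      c p₁ ≠ c p₂ := by
  obtain ⟨a, b, hab, hs⟩ := exists_sublist_of_not_noncrossingWord _ hc
  obtain ⟨f, hf⟩ := List.sublist_iff_exists_fin_orderEmbedding_get_eq.1 hs
  have key : ∀ i : Fin 4, c (Fin.cast (by simp) (f i)) = [a, b, a, b].get i := by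
    intro i
    rw [hf i]
    simp only [List.get_ofFn]
  refine ⟨Fin.cast (by simp) (f (0 : Fin 4)), Fin.cast (by simp) (f (1 : Fin 4)),
    Fin.cast (by simp) (f (2 : Fin 4)), Fin.cast (by simp) (f (3 : Fin 4)), ?_, ?_, ?_, ?_, ?_, ?_⟩
  · exact f.strictMono (by decide : (0 : Fin 4) < 1)
  · exact f.strictMono (by decide : (1 : Fin 4) < 2)
  · exact f.strictMono (by decide : (2 : Fin 4) < 3)
  · rw [key 0, key 2]; rfl
  · rw [key 1, key 3]; rfl
  · rw [key 0, key 1]; exact hab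

theorem openStack_map (g : α → β) (hg : Function.Injective g) (w : List α) :
    openStack (w.map g) = (openStack w).map g := by
  induction w with
  | nil => rfl
  | cons a w ih =>
    rw [List.map_cons, openStack, openStack, ih]
    by_cases h : a ∈ w
    · rw [if_pos h, if_pos (List.mem_map_of_mem h), List.dropWhile_map]
      simp [Function.comp_def, hg.eq_iff]
    · rw [if_neg h, if_neg (by rwa [List.mem_map_of_injective hg]), List.map_cons]

theorem noncrossingWord_map (g : α → β) (hg : Function.Injective g) (w : List α) :
    NoncrossingWord (w.map g) ↔ NoncrossingWord w := by
  induction w with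
  | nil => rfl
  | cons a w ih =>
    rw [List.map_cons, NoncrossingWord, NoncrossingWord, ih, openStack_map g hg,
      List.mem_map_of_injective hg, List.mem_map_of_injective hg]

/-- Returning to one of the open blocks produces each of the heights `1, …, h` exactly once. -/
theorem sum_length_dropWhile (s : List α) (hs : s.Nodup) (φ : ℕ → ℝ) :
    ∑ a ∈ s.toFinset, φ (s.dropWhile (fun b => decide (b ≠ a))).length =
      ∑ m ∈ range s.length, φ (m + 1) := by
  induction s with
  | nil => simp
  | cons b s ih =>
    rw [List.nodup_cons] at hs
    rw [List.toFinset_cons, sum_insert (by simpa using hs.1), List.length_cons, sum_range_succ,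
      ← ih hs.2, add_comm]
    congr 1
    · refine sum_congr rfl fun a ha => ?_
      rw [List.dropWhile_cons_of_pos]
      have : a ∈ s := by simpa using ha
      simp only [decide_not, Bool.not_eq_eq_eq_not, Bool.not_true, decide_eq_false_iff_not]
      rintro rfl
      exact hs.1 this
    · simp

end Noncrossing

/-! ### Counting noncrossing words with a transfer operator. -/

/-- One step of the transfer operator that adds a letter to a noncrossing word with a given number
of open blocks, a new block having weight `ρ`. -/
def transfer (ρ : ℝ) (φ : ℕ → ℝ) (h : ℕ) : ℝ :=
  ρ * φ (h + 1) + ∑ m ∈ range h, φ (m + 1)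

open Classical in
/-- The sum over the noncrossing words of length `n` with letters in `Fin M`, each letter that
occurs having weight `1 / N`, of a function of the number of open blocks. -/
noncomputable def noncrossingSum (M N n : ℕ) (φ : ℕ → ℝ) : ℝ :=
  ∑ c : Fin n → Fin M, if NoncrossingWord (List.ofFn c) then
    ((N : ℝ)⁻¹) ^ (List.ofFn c).toFinset.card * φ (openStack (List.ofFn c)).length else 0

-- A new letter has `M - #used` choices, costs `1 / N` and raises the stack by one. A used letter
-- costs nothing, must be on the stack, and pops to it.
open Classical in
theorem sum_extend_noncrossingWord (M N : ℕ) (φ : ℕ → ℝ) (w : List (Fin M))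
    (hw : NoncrossingWord w) :
    (∑ a : Fin M, if NoncrossingWord (a :: w) then
      ((N : ℝ)⁻¹) ^ (a :: w).toFinset.card * φ (openStack (a :: w)).length else 0) =
    ((N : ℝ)⁻¹) ^ w.toFinset.card * (((M : ℝ) - w.toFinset.card) / N * φ ((openStack w).length + 1)
      + ∑ m ∈ range (openStack w).length, φ (m + 1)) := by
  have hsub : (openStack w).toFinset ⊆ w.toFinset := fun a ha => by
    have := (openStack_sublist w).subset (List.mem_toFinset.1 ha)
    simpa using this
  rw [← sum_add_sum_compl w.toFinset, mul_add, add_comm]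
  congr 1
  · rw [sum_congr rfl (g := fun _ => ((N : ℝ)⁻¹) ^ (w.toFinset.card + 1) *
      φ ((openStack w).length + 1))]
    · rw [sum_const, card_compl, nsmul_eq_mul, Fintype.card_fin, Nat.cast_sub, pow_succ]
      · ring
      · simpa using card_le_univ w.toFinset
    · intro a ha
      have ha : a ∉ w := by simpa using ha
      rw [if_pos ⟨hw, fun h => absurd h ha⟩, openStack_cons_of_notMem ha, List.toFinset_cons,
        card_insert_of_notMem (by simpa using ha), List.length_cons]
  · rw [← sum_length_dropWhile _ (openStack_nodup w), mul_sum, ← sum_subset hsub]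
    · refine sum_congr rfl fun a ha => ?_
      have haw : a ∈ w := by simpa using hsub ha
      rw [if_pos ⟨hw, fun _ => by simpa using ha⟩, openStack, if_pos haw, List.toFinset_cons,
        insert_eq_of_mem (by simpa using haw)]
    · intro a ha ha'
      rw [if_neg]
      rintro ⟨-, h⟩
      exact ha' (by simpa using h (by simpa using ha))

/-- The error comes from replacing the weight `(M - #used) / N` of a new letter by `ρ`, with at most
`n` letters used. -/
theorem noncrossingSum_succ (M N n : ℕ) (φ : ℕ → ℝ) (ρ : ℝ) :
    |noncrossingSum M N (n + 1) φ - noncrossingSum M N n (transfer ρ φ)| ≤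
      (|(M : ℝ) / N - ρ| + n / N) * noncrossingSum M N n (fun h => |φ (h + 1)|) := by
  classical
  have h1 : noncrossingSum M N (n + 1) φ = ∑ w : Fin n → Fin M,
      if NoncrossingWord (List.ofFn w) then ((N : ℝ)⁻¹) ^ (List.ofFn w).toFinset.card *
        (((M : ℝ) - (List.ofFn w).toFinset.card) / N * φ ((openStack (List.ofFn w)).length + 1)
      + ∑ m ∈ range (openStack (List.ofFn w)).length, φ (m + 1)) else 0 := by
    rw [noncrossingSum, ← (Fin.consEquiv (fun _ => Fin M)).sum_comp, Fintype.sum_prod_type_right]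
    refine sum_congr rfl fun w _ => ?_
    simp only [Fin.consEquiv, Equiv.coe_fn_mk, List.ofFn_cons]
    split_ifs with hw
    · exact sum_extend_noncrossingWord M N φ _ hw
    · refine sum_eq_zero fun a _ => if_neg fun h => hw h.1
  rw [h1, noncrossingSum, noncrossingSum, ← sum_sub_distrib, mul_sum]
  refine (abs_sum_le_sum_abs _ _).trans (sum_le_sum fun w _ => ?_)
  split_ifs with hw
  · rw [← mul_sub, abs_mul, mul_left_comm, abs_of_nonneg (by positivity)]
    refine mul_le_mul_of_nonneg_left ?_ (by positivity)
    rw [transfer, add_sub_add_right_eq_sub, ← sub_mul, abs_mul]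
    refine mul_le_mul_of_nonneg_right ?_ (abs_nonneg _)
    rw [sub_div, sub_right_comm]
    refine (abs_sub _ _).trans ?_
    gcongr
    rw [abs_of_nonneg (by positivity)]
    gcongr
    exact (List.toFinset_card_le _).trans (by simp)
  · simp

/-- The induction runs over all `φ`, since the error at each step is a sum of the same kind with `|φ
(h + 1)|`, bounded by the same hypothesis. -/
theorem noncrossingSum_asymptotics (ρ : ℝ) (hρ : 0 < ρ) (n : ℕ) (φ : ℕ → ℝ) :
    ∃ C : ℝ, ∀ N : ℕ, 1 ≤ N →
      |noncrossingSum ⌊ρ * N⌋₊ N n φ - (transfer ρ)^[n] φ 0| ≤ C / N := by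
  induction n generalizing φ with
  | zero =>
    refine ⟨0, fun N _ => ?_⟩
    simp [noncrossingSum, NoncrossingWord, openStack]
  | succ n ih =>
    obtain ⟨C₁, h₁⟩ := ih (transfer ρ φ)
    obtain ⟨C₂, h₂⟩ := ih (fun h => |φ (h + 1)|)
    set b := (transfer ρ)^[n] (fun h => |φ (h + 1)|) 0
    refine ⟨C₁ + (1 + n) * (|b| + |C₂|), fun N hN => ?_⟩
    have hN' : (1 : ℝ) ≤ N := by exact_mod_cast hN
    have hN0 : (0 : ℝ) < N := by linarith
    have h3 := noncrossingSum_succ ⌊ρ * N⌋₊ N n φ ρ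
    have h4 : |(⌊ρ * N⌋₊ : ℝ) / N - ρ| ≤ 1 / N := by
      have e : (⌊ρ * N⌋₊ : ℝ) / N - ρ = (⌊ρ * N⌋₊ - ρ * N) / N := by field_simp
      rw [e, abs_div, abs_of_pos hN0]
      gcongr
      have := Nat.floor_le (mul_pos hρ hN0).le
      have := Nat.lt_floor_add_one (ρ * N)
      rw [abs_le]
      constructor <;> linarith
    have h5 : noncrossingSum ⌊ρ * N⌋₊ N n (fun h => |φ (h + 1)|) ≤ |b| + |C₂| := by
      have h6 := h₂ N hN
      have h7 : C₂ / N ≤ |C₂| := by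
        rw [div_le_iff₀ hN0]
        nlinarith [le_abs_self C₂, abs_nonneg C₂]
      have := le_abs_self b
      have := (abs_le.1 h6).2
      linarith
    have h8 : (|(⌊ρ * N⌋₊ : ℝ) / N - ρ| + n / N) *
        noncrossingSum ⌊ρ * N⌋₊ N n (fun h => |φ (h + 1)|) ≤
        (1 / N + n / N) * (|b| + |C₂|) := by
      refine mul_le_mul (by gcongr) h5 ?_ (by positivity)
      refine sum_nonneg fun c _ => ?_
      split_ifs <;> positivity
    have h9 := h₁ N hN
    rw [Function.iterate_succ_apply]
    calc _ ≤ _ := abs_sub_le _ (noncrossingSum ⌊ρ * N⌋₊ N n (transfer ρ φ)) _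
      _ ≤ (1 / N + n / N) * (|b| + |C₂|) + C₁ / N := add_le_add (h3.trans h8) h9
      _ = _ := by ring

/-! ### Moments of the Marchenko-Pastur law. -/

section MarchenkoPastur

theorem integral_sin_mul_sin_nat (a : ℕ) :
    ∫ θ in (0 : ℝ)..Real.pi, Real.sin θ * Real.sin ((a + 1) * θ) =
      if a = 0 then Real.pi / 2 else 0 := by
  split_ifs with h
  · subst h
    simp only [CharP.cast_eq_zero, zero_add, one_mul, ← sq]
    rw [integral_sin_sq]
    simp
  · have h0 : (a : ℝ) ≠ 0 := by exact_mod_cast h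
    have h2 : (a : ℝ) + 2 ≠ 0 := by positivity
    have e : ∀ θ : ℝ, Real.sin θ * Real.sin ((a + 1) * θ) =
        (1 / 2) * Real.cos (a * θ) - (1 / 2) * Real.cos ((a + 2) * θ) := by
      intro θ
      have e1 : (a : ℝ) * θ = (a + 1) * θ - θ := by ring
      have e2 : ((a : ℝ) + 2) * θ = (a + 1) * θ + θ := by ring
      rw [e1, e2, Real.cos_sub, Real.cos_add]
      ring
    have e3 : Real.sin (((a : ℝ) + 2) * Real.pi) = 0 := by
      have := Real.sin_nat_mul_pi (a + 2)
      push_cast at this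
      exact this
    simp only [e]
    rw [intervalIntegral.integral_sub (by apply Continuous.intervalIntegrable; fun_prop)
      (by apply Continuous.intervalIntegrable; fun_prop), intervalIntegral.integral_const_mul,
      intervalIntegral.integral_const_mul, intervalIntegral.integral_comp_mul_left _ h0,
      intervalIntegral.integral_comp_mul_left _ h2]
    simp [integral_cos, Real.sin_nat_mul_pi, e3]

/-- The point `1 + s exp (i θ)`, the square of whose modulus parametrizes the support of the
Marchenko-Pastur law with parameter `s ^ 2`. -/
noncomputable def mpPoint (s θ : ℝ) : ℂ := 1 + s * Complex.exp (θ * Complex.I)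

theorem continuous_mpPoint (s : ℝ) : Continuous (mpPoint s) := by
  unfold mpPoint
  fun_prop

/-- Each further factor `mpPoint` adds only higher harmonics, which are orthogonal to `sin θ`. For
`a = 0` the value does not depend on `h`, so these functions represent the constant function 1. -/
theorem integral_sin_mul_im (s : ℝ) (a h : ℕ) :
    ∫ θ in (0 : ℝ)..Real.pi,
      Real.sin θ * (Complex.exp (θ * Complex.I) ^ (a + 1) * mpPoint s θ ^ h).im =
      if a = 0 then Real.pi / 2 else 0 := by
  have hc := continuous_mpPoint s
  induction h generalizing a with
  | zero =>
    rw [← integral_sin_mul_sin_nat]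
    congr 1
    ext θ
    rw [pow_zero, mul_one, ← Complex.exp_nat_mul, ← mul_assoc]
    congr 1
    have : ((a + 1 : ℕ) : ℂ) * (θ : ℂ) = (((a + 1) * θ : ℝ) : ℂ) := by push_cast; ring
    rw [this, Complex.exp_ofReal_mul_I_im]
  | succ h ih =>
    have e : ∀ θ : ℝ,
        Real.sin θ * (Complex.exp (θ * Complex.I) ^ (a + 1) * mpPoint s θ ^ (h + 1)).im =
        Real.sin θ * (Complex.exp (θ * Complex.I) ^ (a + 1) * mpPoint s θ ^ h).im +
        s * (Real.sin θ * (Complex.exp (θ * Complex.I) ^ (a + 1 + 1) * mpPoint s θ ^ h).im) := by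
      intro θ
      have : Complex.exp (θ * Complex.I) ^ (a + 1) * mpPoint s θ ^ (h + 1) =
          Complex.exp (θ * Complex.I) ^ (a + 1) * mpPoint s θ ^ h +
          (s : ℂ) * (Complex.exp (θ * Complex.I) ^ (a + 1 + 1) * mpPoint s θ ^ h) := by
        rw [pow_succ (mpPoint s θ)]
        nth_rewrite 2 [mpPoint]
        ring
      rw [this, Complex.add_im, Complex.im_ofReal_mul]
      ring
    simp only [e]
    rw [intervalIntegral.integral_add (by apply Continuous.intervalIntegrable; fun_prop)
      (by apply Continuous.intervalIntegrable; fun_prop), intervalIntegral.integral_const_mul, ih,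
      ih]
    simp

/-- With `z = e^{iθ}` and `x = 1 + s z`, one has `|x|² z x^h = z x^(h+1) + s x^(h+1)` because `|z| =
1`. As `x - 1 = s z`, the geometric sum turns the last term into the sum over `m`, up to a real
number. -/
theorem normSq_mpPoint_mul_im (s θ : ℝ) (h : ℕ) :
    Complex.normSq (mpPoint s θ) * (Complex.exp (θ * Complex.I) * mpPoint s θ ^ h).im =
      (Complex.exp (θ * Complex.I) * mpPoint s θ ^ (h + 1)).im +
      s ^ 2 * ∑ m ∈ range (h + 1), (Complex.exp (θ * Complex.I) * mpPoint s θ ^ m).im := by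
  set z := Complex.exp (θ * Complex.I) with hz
  set x := mpPoint s θ with hx
  have hxz : x = 1 + s * z := rfl
  have hzz : z * (starRingEnd ℂ) z = 1 := by
    rw [Complex.mul_conj, Complex.normSq_eq_norm_sq, hz, Complex.norm_exp_ofReal_mul_I]
    simp
  have h1 : (s : ℂ) * (z * ∑ m ∈ range (h + 1), x ^ m) = x ^ (h + 1) - 1 := by
    rw [← mul_geom_sum, hxz]
    ring
  have h2 : s ^ 2 * ∑ m ∈ range (h + 1), (z * x ^ m).im = s * (x ^ (h + 1)).im := by
    have h3 := congrArg Complex.im h1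
    rw [Complex.im_ofReal_mul, mul_sum, Complex.im_sum, Complex.sub_im, Complex.one_im,
      sub_zero] at h3
    rw [← h3]
    ring
  rw [h2, ← Complex.im_ofReal_mul, ← Complex.im_ofReal_mul, ← Complex.add_im]
  congr 1
  rw [Complex.normSq_eq_conj_mul_self]
  have h4 : (starRingEnd ℂ) x = 1 + s * (starRingEnd ℂ) z := by
    rw [hxz]
    simp
  rw [h4]
  calc _ = z * x ^ (h + 1) + s * (z * (starRingEnd ℂ) z) * x ^ (h + 1) := by ring
    _ = _ := by rw [hzz]; ring

/-- The iterates of the transfer operator as integrals against the Marchenko-Pastur law. -/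
theorem transfer_iterate_one (ρ : ℝ) (hρ : 0 < ρ) (n h : ℕ) :
    (transfer ρ)^[n] (fun _ => 1) (h + 1) = ρ ^ n * ((2 / Real.pi) *
      ∫ θ in (0 : ℝ)..Real.pi, Complex.normSq (mpPoint (Real.sqrt ρ⁻¹) θ) ^ n *
        (Real.sin θ * (Complex.exp (θ * Complex.I) * mpPoint (Real.sqrt ρ⁻¹) θ ^ h).im)) := by
  have hc := continuous_mpPoint (Real.sqrt ρ⁻¹)
  have hs : Real.sqrt ρ⁻¹ ^ 2 = ρ⁻¹ := Real.sq_sqrt (by positivity)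
  set s := Real.sqrt ρ⁻¹
  have hns : Continuous fun θ => Complex.normSq (mpPoint s θ) := Complex.continuous_normSq.comp hc
  induction n generalizing h with
  | zero =>
    have := integral_sin_mul_im s 0 h
    simp only [zero_add, pow_one, if_true] at this
    simp only [pow_zero, one_mul, this, Function.iterate_zero, id_eq]
    have := Real.pi_ne_zero
    field_simp
  | succ n ih =>
    rw [Function.iterate_succ_apply', transfer, ih, sum_congr rfl fun m _ => ih m, ← mul_sum,
      ← mul_sum, ← intervalIntegral.integral_finsetSum]
    · have e : ∀ θ : ℝ, Complex.normSq (mpPoint s θ) ^ (n + 1) *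
          (Real.sin θ * (Complex.exp (θ * Complex.I) * mpPoint s θ ^ h).im) =
          Complex.normSq (mpPoint s θ) ^ n *
          (Real.sin θ * (Complex.exp (θ * Complex.I) * mpPoint s θ ^ (h + 1)).im) +
          ρ⁻¹ * ∑ m ∈ range (h + 1), Complex.normSq (mpPoint s θ) ^ n *
          (Real.sin θ * (Complex.exp (θ * Complex.I) * mpPoint s θ ^ m).im) := by
        intro θ
        have := normSq_mpPoint_mul_im s θ h
        rw [hs] at this
        rw [← mul_sum, ← mul_sum, pow_succ]
        linear_combination (Complex.normSq (mpPoint s θ) ^ n * Real.sin θ) * this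
      simp only [e]
      rw [intervalIntegral.integral_add (by apply Continuous.intervalIntegrable; fun_prop)
        (by apply Continuous.intervalIntegrable; fun_prop), intervalIntegral.integral_const_mul]
      have hρ' := mul_inv_cancel₀ hρ.ne'
      linear_combination (-(ρ ^ n * (2 / Real.pi) * ∫ θ in (0 : ℝ)..Real.pi,
        ∑ m ∈ range (h + 1), Complex.normSq (mpPoint s θ) ^ n *
          (Real.sin θ * (Complex.exp (θ * Complex.I) * mpPoint s θ ^ m).im))) * hρ'
    · intro m _
      apply Continuous.intervalIntegrable
      fun_prop

theorem normSq_mpPoint (s θ : ℝ) :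
    Complex.normSq (mpPoint s θ) = 1 + s ^ 2 + 2 * s * Real.cos θ := by
  rw [mpPoint, Complex.normSq_apply]
  simp only [Complex.add_re, Complex.one_re, Complex.re_ofReal_mul, Complex.exp_ofReal_mul_I_re,
    Complex.add_im, Complex.one_im, Complex.im_ofReal_mul, Complex.exp_ofReal_mul_I_im]
  linear_combination s ^ 2 * Real.sin_sq_add_cos_sq θ

/-- Rescale by `ρ`, cancel one factor `u` against the density, and substitute `u = |1 + s e^{iθ}|² =
1 + s² + 2 s cos θ`. The square root becomes `2 s sin θ`, and the Jacobian contributes the second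
sine. -/
theorem rescaledMPMoment_eq_integral (ρ : ℝ) (hρ : 0 < ρ) (n : ℕ) :
    rescaledMPMoment ρ (n + 1) = ρ ^ (n + 1) * ((2 / Real.pi) *
      ∫ θ in (0 : ℝ)..Real.pi, Complex.normSq (mpPoint (Real.sqrt ρ⁻¹) θ) ^ n *
        (Real.sin θ * Real.sin θ)) := by
  have hs0 : 0 < Real.sqrt ρ⁻¹ := Real.sqrt_pos.2 (by positivity)
  have hs : Real.sqrt ρ⁻¹ ^ 2 = ρ⁻¹ := Real.sq_sqrt (by positivity)
  have hπ := Real.pi_pos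
  set s := Real.sqrt ρ⁻¹ with hsdef
  have h1 : rescaledMPMoment ρ (n + 1) =
      ρ ^ (n + 1) * ∫ u : ℝ, u ^ (n + 1) * marchenkoPasturDensity ρ⁻¹ u := by
    have := MeasureTheory.Measure.integral_comp_div
      (fun u : ℝ => u ^ (n + 1) * marchenkoPasturDensity ρ⁻¹ u) ρ
    rw [abs_of_pos hρ, smul_eq_mul] at this
    rw [rescaledMPMoment, pow_succ, mul_assoc, ← this, ← MeasureTheory.integral_const_mul]
    congr 1
    ext t
    rw [rescaledMPDensity, div_pow, pow_succ ρ]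
    field_simp
  have hab : (1 - s) ^ 2 ≤ (1 + s) ^ 2 := by nlinarith
  set g : ℝ → ℝ := fun u =>
    u ^ n * (Real.sqrt (((1 + s) ^ 2 - u) * (u - (1 - s) ^ 2)) / (2 * Real.pi * ρ⁻¹)) with hg
  have h2 : ∫ u : ℝ, u ^ (n + 1) * marchenkoPasturDensity ρ⁻¹ u =
      ∫ u in ((1 - s) ^ 2)..((1 + s) ^ 2), g u := by
    rw [intervalIntegral.integral_of_le hab, ← MeasureTheory.integral_Icc_eq_integral_Ioc,
      ← MeasureTheory.integral_indicator measurableSet_Icc]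
    refine MeasureTheory.integral_congr_ae ?_
    have : ∀ᵐ u : ℝ, u ≠ 0 := by simp [MeasureTheory.ae_iff]
    filter_upwards [this] with u hu
    rw [marchenkoPasturDensity, ← hsdef]
    by_cases hu' : u ∈ Set.Icc ((1 - s) ^ 2) ((1 + s) ^ 2)
    · rw [Set.indicator_of_mem hu', Set.indicator_of_mem hu', hg]
      field_simp
      ring
    · rw [Set.indicator_of_notMem hu', Set.indicator_of_notMem hu', mul_zero]
  have h3 := intervalIntegral.integral_comp_mul_deriv (a := 0) (b := Real.pi)
    (f := fun θ => 1 + s ^ 2 + 2 * s * Real.cos θ) (f' := fun θ => 2 * s * (-Real.sin θ)) (g := g)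
    (fun θ _ => ((Real.hasDerivAt_cos θ).const_mul (2 * s)).const_add _)
    (by fun_prop) (by fun_prop)
  have e1 : 1 + s ^ 2 + 2 * s * Real.cos 0 = (1 + s) ^ 2 := by rw [Real.cos_zero]; ring
  have e2 : 1 + s ^ 2 + 2 * s * Real.cos Real.pi = (1 - s) ^ 2 := by rw [Real.cos_pi]; ring
  rw [h1, h2, intervalIntegral.integral_symm]
  congr 1
  simp only [e1, e2] at h3
  rw [← h3, ← intervalIntegral.integral_neg, ← intervalIntegral.integral_const_mul]
  refine intervalIntegral.integral_congr fun θ hθ => ?_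
  rw [Set.uIcc_of_le hπ.le] at hθ
  have hsin := Real.sin_nonneg_of_nonneg_of_le_pi hθ.1 hθ.2
  have e3 : Real.sqrt (((1 + s) ^ 2 - (1 + s ^ 2 + 2 * s * Real.cos θ)) *
      ((1 + s ^ 2 + 2 * s * Real.cos θ) - (1 - s) ^ 2)) = 2 * s * Real.sin θ := by
    rw [← Real.sqrt_sq (by positivity : 0 ≤ 2 * s * Real.sin θ)]
    congr 1
    linear_combination -(4 * s ^ 2) * Real.sin_sq_add_cos_sq θ
  simp only [Function.comp_apply, hg, e3, normSq_mpPoint]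
  field_simp
  rw [hs]
  field_simp

/-- On an empty stack only a new letter is possible, so the last step contributes just a factor `ρ`.
-/
theorem transfer_iterate_one_zero (ρ : ℝ) (hρ : 0 < ρ) (n : ℕ) :
    (transfer ρ)^[n + 1] (fun _ => 1) 0 = rescaledMPMoment ρ (n + 1) := by
  rw [Function.iterate_succ_apply', transfer, transfer_iterate_one ρ hρ,
    rescaledMPMoment_eq_integral ρ hρ]
  simp only [pow_zero, mul_one, Complex.exp_ofReal_mul_I_im, range_zero, sum_empty, add_zero,
    pow_succ]
  ring

end MarchenkoPastur

/-! ### Exponential sums over quasi-random frequencies. -/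

section ExponentialSums

theorem expe_add (s t : ℝ) : expe (s + t) = expe s * expe t := by
  rw [expe, expe, expe, ← Complex.exp_add]
  congr 1
  push_cast
  ring

theorem expe_zero : expe 0 = 1 := by simp [expe]

theorem norm_expe (t : ℝ) : ‖expe t‖ = 1 := by
  rw [expe, show (2 * Real.pi * Complex.I * t : ℂ) = ((2 * Real.pi * t : ℝ) : ℂ) * Complex.I by
    push_cast; ring]
  exact Complex.norm_exp_ofReal_mul_I _

theorem conj_expe (t : ℝ) : (starRingEnd ℂ) (expe t) = expe (-t) := by
  rw [expe, expe, ← Complex.exp_conj]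
  simp only [map_mul, Complex.conj_ofReal, Complex.conj_I, Complex.conj_ofNat, Complex.ofReal_neg]
  congr 1
  ring

theorem expe_sum {ι : Type*} (s : Finset ι) (f : ι → ℝ) :
    expe (∑ i ∈ s, f i) = ∏ i ∈ s, expe (f i) := by
  classical
  induction s using Finset.induction_on with
  | empty => simp [expe_zero]
  | insert a s ha ih => rw [sum_insert ha, prod_insert ha, expe_add, ih]

/-- The exponential sum over the first `M` frequencies. -/
noncomputable def freqSum (M : ℕ) (ω : ℕ → ℝ) (q : ℝ) : ℂ := ∑ i ∈ range M, expe (ω i * q)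

theorem norm_freqSum_le (M : ℕ) (ω : ℕ → ℝ) (q : ℝ) : ‖freqSum M ω q‖ ≤ M := by
  refine (norm_sum_le _ _).trans ?_
  simp [norm_expe]

theorem freqSum_zero (M : ℕ) (ω : ℕ → ℝ) : freqSum M ω 0 = M := by
  simp [freqSum, expe_zero]

theorem norm_sum_expe_sq {ι : Type*} (s : Finset ι) (f : ι → ℝ) :
    ((‖∑ i ∈ s, expe (f i)‖ ^ 2 : ℝ) : ℂ) = ∑ i ∈ s, ∑ i' ∈ s, expe (f i - f i') := by
  have := Complex.mul_conj (∑ i ∈ s, expe (f i))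
  rw [Complex.normSq_eq_norm_sq] at this
  rw [← this, map_sum, sum_mul_sum]
  refine sum_congr rfl fun i _ => sum_congr rfl fun i' _ => ?_
  rw [conj_expe, ← expe_add, sub_eq_add_neg]

theorem sum_comm_three {ι κ R : Type*} [AddCommMonoid R] (s : Finset ι) (t u : Finset κ)
    (F : ι → κ → κ → R) :
    ∑ j ∈ s, ∑ i₁ ∈ t, ∑ i₂ ∈ u, F j i₁ i₂ = ∑ i₁ ∈ t, ∑ i₂ ∈ u, ∑ j ∈ s, F j i₁ i₂ := by
  rw [sum_comm]
  exact sum_congr rfl fun _ _ => sum_comm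

/-- The fourth moment of the phase sums, in terms of which quasi-randomness is expressed. -/
noncomputable def quadSum (M N : ℕ) (ω : ℕ → ℝ) : ℝ :=
  ∑ j₁ ∈ Icc 1 N, ∑ j₂ ∈ Icc 1 N, ∑ j₃ ∈ Icc 1 N, ∑ j₄ ∈ Icc 1 N,
    if j₁ + j₃ = j₂ + j₄ then ‖freqSum M ω (((j₁ : ℝ) - j₂) * ((j₂ : ℝ) - j₃))‖ ^ 2 else 0

theorem quadSum_nonneg (M N : ℕ) (ω : ℕ → ℝ) : 0 ≤ quadSum M N ω := by
  unfold quadSum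
  refine sum_nonneg fun _ _ => sum_nonneg fun _ _ => sum_nonneg fun _ _ => sum_nonneg fun _ _ => ?_
  split_ifs <;> positivity

/-- On `j₁ + j₃ = j₂ + j₄` the quadratic form factors: half of `j₁² - j₂² + j₃² - j₄²` is `(j₁ -
j₂)(j₂ - j₃)`. Summing over `i₁, i₂` then gives a squared modulus, so the sum is nonnegative and may
be restricted to fewer terms. -/
theorem quadSum_eq (ρ : ℝ) (ω : ℕ → ℝ) (N : ℕ) (hN : 1 ≤ N) :
    quadSum ⌊ρ * N⌋₊ N ω = N ^ 5 * ‖expSumES ρ ω N‖ := by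
  have key : ((quadSum ⌊ρ * N⌋₊ N ω : ℝ) : ℂ) = (N : ℂ) ^ 5 * expSumES ρ ω N := by
    have hN0 : (N : ℂ) ≠ 0 := by exact_mod_cast (by omega : N ≠ 0)
    rw [expSumES, ← mul_assoc, mul_one_div_cancel (pow_ne_zero _ hN0), one_mul, quadSum]
    simp only [Complex.ofReal_sum]
    have h : ∀ j₁ j₂ j₃ j₄ : ℕ, (((if j₁ + j₃ = j₂ + j₄ then
        ‖freqSum ⌊ρ * N⌋₊ ω (((j₁ : ℝ) - j₂) * ((j₂ : ℝ) - j₃))‖ ^ 2 else 0 : ℝ)) : ℂ) =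
        ∑ i₁ ∈ range ⌊ρ * N⌋₊, ∑ i₂ ∈ range ⌊ρ * N⌋₊, if j₁ + j₃ = j₂ + j₄ then
          expe ((ω i₁ - ω i₂) / 2 *
            ((j₁ : ℝ) ^ 2 - (j₂ : ℝ) ^ 2 + (j₃ : ℝ) ^ 2 - (j₄ : ℝ) ^ 2)) else 0 := by
      intro j₁ j₂ j₃ j₄
      split_ifs with hj
      · have hj' : (j₄ : ℝ) = j₁ + j₃ - j₂ := by
          have : (j₁ : ℝ) + j₃ = j₂ + j₄ := by exact_mod_cast hj
          linarith
        rw [freqSum, norm_sum_expe_sq]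
        refine sum_congr rfl fun i _ => sum_congr rfl fun i' _ => ?_
        rw [hj']
        congr 1
        ring
      · simp
    simp only [h]
    refine Eq.trans (sum_congr rfl fun j₁ _ => ?_) (sum_comm_three _ _ _ _)
    refine Eq.trans (sum_congr rfl fun j₂ _ => ?_) (sum_comm_three _ _ _ _)
    refine Eq.trans (sum_congr rfl fun j₃ _ => ?_) (sum_comm_three _ _ _ _)
    exact sum_comm_three _ _ _ _
  have hnn := quadSum_nonneg ⌊ρ * N⌋₊ N ω
  have := congrArg norm key
  rw [Complex.norm_real, Real.norm_of_nonneg hnn] at this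
  rw [this]
  simp

/-- The contribution of the diagonal `j₁ = j₂`, `j₃ = j₄`. -/
theorem sq_mul_sq_le_quadSum (M N : ℕ) (ω : ℕ → ℝ) :
    (N : ℝ) ^ 2 * (M : ℝ) ^ 2 ≤ quadSum M N ω := by
  have h : ∀ j₁ ∈ Icc 1 N, ∀ j₃ ∈ Icc 1 N, (M : ℝ) ^ 2 ≤ ∑ j₄ ∈ Icc 1 N,
      if j₁ + j₃ = j₁ + j₄ then ‖freqSum M ω (((j₁ : ℝ) - j₁) * ((j₁ : ℝ) - j₃))‖ ^ 2 else 0 := by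
    intro j₁ _ j₃ h₃
    refine le_trans ?_ (single_le_sum (fun j₄ _ => ?_) h₃)
    · simp [freqSum_zero]
    · split_ifs <;> positivity
  calc (N : ℝ) ^ 2 * (M : ℝ) ^ 2 = ∑ j₁ ∈ Icc 1 N, ∑ j₃ ∈ Icc 1 N, (M : ℝ) ^ 2 := by
        simp only [sum_const, Nat.card_Icc, add_tsub_cancel_right, nsmul_eq_mul]
        ring
    _ ≤ _ := sum_le_sum fun j₁ h₁ => (sum_le_sum fun j₃ h₃ => h j₁ h₁ j₃ h₃).trans
        (single_le_sum (f := fun j₂ => ∑ j₃ ∈ Icc 1 N, ∑ j₄ ∈ Icc 1 N,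
          if j₁ + j₃ = j₂ + j₄ then ‖freqSum M ω (((j₁ : ℝ) - j₂) * ((j₂ : ℝ) - j₃))‖ ^ 2 else 0)
          (fun j₂ _ => sum_nonneg fun j₃ _ => sum_nonneg fun j₄ _ => by
            split_ifs <;> positivity) h₁)

/-- For fixed `s'`, `t'`, solve `j₁ - j₂ = s - s'` and `j₂ - j₃ = t - t'`. The common translation
`m` is free and produces the factor `L`. -/
theorem sum_freqSum_sq_le_quadSum (M N L : ℕ) (hL : 5 * L ≤ N) (ω : ℕ → ℝ) (s' t' : ℕ)
    (hs' : s' < L) (ht' : t' < L) :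
    (L : ℝ) * ∑ s ∈ range L, ∑ t ∈ range L,
      ‖freqSum M ω (((s : ℝ) - s') * ((t : ℝ) - t'))‖ ^ 2 ≤ quadSum M N ω := by
  set G : (ℕ × ℕ) × (ℕ × ℕ) → ℝ := fun p => if p.1.1 + p.2.1 = p.1.2 + p.2.2 then
    ‖freqSum M ω (((p.1.1 : ℝ) - p.1.2) * ((p.1.2 : ℝ) - p.2.1))‖ ^ 2 else 0 with hG
  have hG0 : ∀ p, 0 ≤ G p := fun p => by
    simp only [hG]
    split_ifs <;> positivity
  have hQ : quadSum M N ω = ∑ p ∈ (Icc 1 N ×ˢ Icc 1 N) ×ˢ (Icc 1 N ×ˢ Icc 1 N), G p := by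
    simp only [sum_product, hG, quadSum]
  -- The offset `2 * L` keeps all entries positive and the natural subtractions exact; the largest
  -- entry stays below `5 * L ≤ N`.
  set e : ℕ × (ℕ × ℕ) → (ℕ × ℕ) × (ℕ × ℕ) := fun q =>
    ((2 * L + q.1 + q.2.1 - s', 2 * L + q.1), (2 * L + q.1 + t' - q.2.2,
      2 * L + q.1 + q.2.1 + t' - s' - q.2.2)) with he
  have hS : (L : ℝ) * ∑ s ∈ range L, ∑ t ∈ range L,
      ‖freqSum M ω (((s : ℝ) - s') * ((t : ℝ) - t'))‖ ^ 2 =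
      ∑ q ∈ range L ×ˢ (range L ×ˢ range L), G (e q) := by
    rw [sum_product, ← nsmul_eq_mul, ← card_range L, ← sum_const, card_range]
    refine sum_congr rfl fun m _ => ?_
    rw [sum_product]
    refine sum_congr rfl fun s hs => sum_congr rfl fun t ht => ?_
    rw [mem_range] at hs ht
    simp only [hG, he]
    rw [if_pos (by omega), Nat.cast_sub (by omega), Nat.cast_sub (by omega)]
    push_cast
    congr 3
    ring
  rw [hS, hQ, ← sum_image (f := G) (g := e)]
  · refine sum_le_sum_of_subset_of_nonneg ?_ fun p _ _ => hG0 p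
    intro p hp
    obtain ⟨⟨m, s, t⟩, hq, rfl⟩ := mem_image.1 hp
    simp only [mem_product, mem_range] at hq
    simp only [he, mem_product, mem_Icc]
    omega
  · rintro ⟨m, s, t⟩ hq ⟨m', s₁, t₁⟩ hq' h
    simp only [coe_product, coe_range, Set.mem_prod, Set.mem_Iio] at hq hq'
    simp only [he, Prod.mk.injEq] at h ⊢
    omega

theorem sum_range_four_freqSum_le (M N L : ℕ) (hL : 5 * L ≤ N) (ω : ℕ → ℝ) :
    ∑ s ∈ range L, ∑ s' ∈ range L, ∑ t ∈ range L, ∑ t' ∈ range L,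
      ‖freqSum M ω (((s : ℝ) - s') * ((t : ℝ) - t'))‖ ^ 2 ≤ L * quadSum M N ω := by
  rcases Nat.eq_zero_or_pos L with rfl | hL0
  · simp
  have hL0' : (0 : ℝ) < L := by exact_mod_cast hL0
  refine le_of_mul_le_mul_left ?_ hL0'
  calc _ = ∑ s' ∈ range L, ∑ t' ∈ range L, (L : ℝ) * ∑ s ∈ range L, ∑ t ∈ range L,
        ‖freqSum M ω (((s : ℝ) - s') * ((t : ℝ) - t'))‖ ^ 2 := by
        rw [sum_comm]
        simp only [mul_sum]
        refine sum_congr rfl fun s' _ => ?_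
        rw [sum_comm (s := range L) (t := range L)
          (f := fun t' s => ∑ t ∈ range L, (L : ℝ) *
            ‖freqSum M ω (((s : ℝ) - s') * ((t : ℝ) - t'))‖ ^ 2)]
        exact sum_congr rfl fun s _ => sum_comm
    _ ≤ ∑ s' ∈ range L, ∑ t' ∈ range L, quadSum M N ω :=
        sum_le_sum fun s' hs' => sum_le_sum fun t' ht' =>
          sum_freqSum_sq_le_quadSum M N L hL ω s' t' (mem_range.1 hs') (mem_range.1 ht')
    _ = _ := by simp [← mul_assoc]

/-- The box norm inequality for a bilinear phase. -/
theorem norm_sum_bilinear_pow_four_le (L : ℕ) (a b : ℕ → ℝ) (θ : ℝ) :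
    ((‖∑ s ∈ range L, ∑ t ∈ range L, expe (a s + b t + θ * (s * t))‖ ^ 4 : ℝ)) ≤
      (L : ℝ) ^ 4 * (∑ t ∈ range L, ∑ t' ∈ range L,
        ‖∑ s ∈ range L, expe (θ * (s * ((t : ℝ) - t')))‖ ^ 2) := by
  -- Cauchy-Schwarz in `s` removes `a`.
  have h1 : ‖∑ s ∈ range L, ∑ t ∈ range L, expe (a s + b t + θ * (s * t))‖ ^ 2 ≤
      L * ∑ s ∈ range L, ‖∑ t ∈ range L, expe (b t + θ * (s * t))‖ ^ 2 := by
    have e : ∀ s : ℕ, ∑ t ∈ range L, expe (a s + b t + θ * (s * t)) =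
        expe (a s) * ∑ t ∈ range L, expe (b t + θ * (s * t)) := fun s => by
      rw [mul_sum]
      exact sum_congr rfl fun t _ => by rw [← expe_add, add_assoc]
    have h := sq_sum_le_card_mul_sum_sq (s := range L)
      (f := fun s : ℕ => ‖∑ t ∈ range L, expe (b t + θ * (s * t))‖)
    rw [card_range] at h
    refine le_trans ?_ h
    refine pow_le_pow_left₀ (norm_nonneg _) ((norm_sum_le _ _).trans (le_of_eq ?_)) 2
    exact sum_congr rfl fun s _ => by rw [e, norm_mul, norm_expe, one_mul]
  -- After opening the square, `b` enters only through a factor of modulus 1 outside the sum over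
  -- `s`.
  have h2 : ∑ s ∈ range L, ‖∑ t ∈ range L, expe (b t + θ * (s * t))‖ ^ 2 ≤
      ∑ t ∈ range L, ∑ t' ∈ range L, ‖∑ s ∈ range L, expe (θ * (s * ((t : ℝ) - t')))‖ := by
    have h : ((∑ s ∈ range L, ‖∑ t ∈ range L, expe (b t + θ * (s * t))‖ ^ 2 : ℝ) : ℂ) =
        ∑ t ∈ range L, ∑ t' ∈ range L, expe (b t - b t') *
          ∑ s ∈ range L, expe (θ * (s * ((t : ℝ) - t'))) := by
      rw [Complex.ofReal_sum]
      simp only [norm_sum_expe_sq]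
      rw [sum_comm]
      refine sum_congr rfl fun t _ => ?_
      rw [sum_comm]
      refine sum_congr rfl fun t' _ => ?_
      rw [mul_sum]
      refine sum_congr rfl fun s _ => ?_
      rw [← expe_add]
      congr 1
      ring
    have hn := congrArg norm h
    rw [Complex.norm_real, Real.norm_of_nonneg (sum_nonneg fun _ _ => by positivity)] at hn
    rw [hn]
    refine (norm_sum_le _ _).trans (sum_le_sum fun t _ => (norm_sum_le _ _).trans (le_of_eq ?_))
    exact sum_congr rfl fun t' _ => by rw [norm_mul, norm_expe, one_mul]
  have h3 : (∑ t ∈ range L, ∑ t' ∈ range L, ‖∑ s ∈ range L, expe (θ * (s * ((t : ℝ) - t')))‖) ^ 2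
      ≤ (L : ℝ) ^ 2 * ∑ t ∈ range L, ∑ t' ∈ range L,
        ‖∑ s ∈ range L, expe (θ * (s * ((t : ℝ) - t')))‖ ^ 2 := by
    have h := sq_sum_le_card_mul_sum_sq (s := range L ×ˢ range L)
      (f := fun p : ℕ × ℕ => ‖∑ s ∈ range L, expe (θ * (s * ((p.1 : ℝ) - p.2)))‖)
    simp only [sum_product, card_product, card_range, Nat.cast_mul] at h
    rwa [sq (L : ℝ)]
  calc _ = (‖∑ s ∈ range L, ∑ t ∈ range L, expe (a s + b t + θ * (s * t))‖ ^ 2) ^ 2 := by ring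
    _ ≤ (L * ∑ t ∈ range L, ∑ t' ∈ range L,
        ‖∑ s ∈ range L, expe (θ * (s * ((t : ℝ) - t')))‖) ^ 2 := by
        refine pow_le_pow_left₀ (by positivity) (h1.trans ?_) 2
        gcongr
    _ = (L : ℝ) ^ 2 * (∑ t ∈ range L, ∑ t' ∈ range L,
        ‖∑ s ∈ range L, expe (θ * (s * ((t : ℝ) - t')))‖) ^ 2 := by ring
    _ ≤ (L : ℝ) ^ 2 * ((L : ℝ) ^ 2 * ∑ t ∈ range L, ∑ t' ∈ range L,
        ‖∑ s ∈ range L, expe (θ * (s * ((t : ℝ) - t')))‖ ^ 2) := by gcongr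
    _ = _ := by ring

theorem pow_four_sum_le {ι : Type*} (s : Finset ι) (f : ι → ℝ) :
    (∑ i ∈ s, f i) ^ 4 ≤ (s.card : ℝ) ^ 3 * ∑ i ∈ s, f i ^ 4 := by
  have h1 := sq_sum_le_card_mul_sum_sq (s := s) (f := f)
  have h2 := sq_sum_le_card_mul_sum_sq (s := s) (f := fun i => f i ^ 2)
  calc (∑ i ∈ s, f i) ^ 4 = ((∑ i ∈ s, f i) ^ 2) ^ 2 := by ring
    _ ≤ (s.card * ∑ i ∈ s, f i ^ 2) ^ 2 := pow_le_pow_left₀ (by positivity) h1 2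
    _ = (s.card : ℝ) ^ 2 * (∑ i ∈ s, f i ^ 2) ^ 2 := by ring
    _ ≤ (s.card : ℝ) ^ 2 * (s.card * ∑ i ∈ s, (f i ^ 2) ^ 2) := by gcongr
    _ = (s.card : ℝ) ^ 3 * ∑ i ∈ s, (f i ^ 2) ^ 2 := by ring
    _ = _ := by simp only [← pow_mul]

/-- Open the square into `M²` pairs of frequencies, apply Hölder over the pairs (whence `M ^ 6`) and
the box norm inequality to each. Summing over the pairs again reassembles `freqSum` at `(s - s')(t -
t')`, where `a` and `b` have disappeared. -/
theorem sum_freqSum_sq_pow_four_le (M N L : ℕ) (hL : 5 * L ≤ N) (ω : ℕ → ℝ) (a b : ℕ → ℝ)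
    (ε : ℝ) (hε : ε = 1 ∨ ε = -1) :
    (∑ s ∈ range L, ∑ t ∈ range L, ‖freqSum M ω (a s + b t + ε * (s * t))‖ ^ 2) ^ 4 ≤
      (M : ℝ) ^ 6 * ((L : ℝ) ^ 4 * (L * quadSum M N ω)) := by
  set Z : ℕ × ℕ → ℝ := fun p =>
    ‖∑ s ∈ range L, ∑ t ∈ range L, expe ((ω p.1 - ω p.2) * (a s + b t + ε * (s * t)))‖ with hZ
  have h1 : ∑ s ∈ range L, ∑ t ∈ range L, ‖freqSum M ω (a s + b t + ε * (s * t))‖ ^ 2 ≤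
      ∑ p ∈ range M ×ˢ range M, Z p := by
    have h : ((∑ s ∈ range L, ∑ t ∈ range L,
        ‖freqSum M ω (a s + b t + ε * (s * t))‖ ^ 2 : ℝ) : ℂ) =
        ∑ p ∈ range M ×ˢ range M, ∑ s ∈ range L, ∑ t ∈ range L,
          expe ((ω p.1 - ω p.2) * (a s + b t + ε * (s * t))) := by
      simp only [Complex.ofReal_sum, freqSum, norm_sum_expe_sq, ← sub_mul, sum_product]
      refine Eq.trans (sum_congr rfl fun s _ => ?_) (sum_comm_three _ _ _ _)
      exact sum_comm_three _ _ _ _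
    have hn := congrArg norm h
    rw [Complex.norm_real, Real.norm_of_nonneg
      (sum_nonneg fun _ _ => sum_nonneg fun _ _ => by positivity)] at hn
    rw [hn]
    exact norm_sum_le _ _
  have h2 : ∀ p : ℕ × ℕ, Z p ^ 4 ≤ (L : ℝ) ^ 4 * ∑ t ∈ range L, ∑ t' ∈ range L,
      ‖∑ s ∈ range L, expe ((ω p.1 - ω p.2) * (s * ((t : ℝ) - t')))‖ ^ 2 := by
    intro p
    have h := norm_sum_bilinear_pow_four_le L (fun s => (ω p.1 - ω p.2) * a s)
      (fun t => (ω p.1 - ω p.2) * b t) ((ω p.1 - ω p.2) * ε)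
    simp only [mul_assoc, ← mul_add] at h
    refine h.trans (le_of_eq ?_)
    congr 1
    refine sum_congr rfl fun t _ => sum_congr rfl fun t' _ => ?_
    rcases hε with rfl | rfl
    · simp
    · have e : ∀ s : ℕ, expe ((ω p.1 - ω p.2) * (-1 * (s * ((t : ℝ) - t')))) =
          (starRingEnd ℂ) (expe ((ω p.1 - ω p.2) * (s * ((t : ℝ) - t')))) := by
        intro s
        rw [conj_expe]
        congr 1
        ring
      simp only [e, ← map_sum, RCLike.norm_conj]
  have h3 : ∑ p ∈ range M ×ˢ range M, ∑ t ∈ range L, ∑ t' ∈ range L,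
      ‖∑ s ∈ range L, expe ((ω p.1 - ω p.2) * (s * ((t : ℝ) - t')))‖ ^ 2 =
      ∑ s ∈ range L, ∑ s' ∈ range L, ∑ t ∈ range L, ∑ t' ∈ range L,
      ‖freqSum M ω (((s : ℝ) - s') * ((t : ℝ) - t'))‖ ^ 2 := by
    have e : ∀ t t' : ℕ, ∑ p ∈ range M ×ˢ range M,
        ‖∑ s ∈ range L, expe ((ω p.1 - ω p.2) * (s * ((t : ℝ) - t')))‖ ^ 2 =
        ∑ s ∈ range L, ∑ s' ∈ range L, ‖freqSum M ω (((s : ℝ) - s') * ((t : ℝ) - t'))‖ ^ 2 := by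
      intro t t'
      rw [← Complex.ofReal_inj]
      simp only [Complex.ofReal_sum, freqSum, norm_sum_expe_sq]
      rw [sum_comm_three]
      refine sum_congr rfl fun s _ => sum_congr rfl fun s' _ => ?_
      rw [sum_product]
      refine sum_congr rfl fun i _ => sum_congr rfl fun i' _ => ?_
      congr 1
      ring
    rw [sum_comm_three]
    simp only [e]
    refine Eq.trans (sum_congr rfl fun t _ => ?_) (sum_comm_three _ _ _ _)
    exact sum_comm_three _ _ _ _
  calc _ ≤ (∑ p ∈ range M ×ˢ range M, Z p) ^ 4 := pow_le_pow_left₀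
        (sum_nonneg fun _ _ => sum_nonneg fun _ _ => by positivity) h1 4
    _ ≤ ((range M ×ˢ range M).card : ℝ) ^ 3 * ∑ p ∈ range M ×ˢ range M, Z p ^ 4 :=
        pow_four_sum_le _ _
    _ ≤ ((range M ×ˢ range M).card : ℝ) ^ 3 * ∑ p ∈ range M ×ˢ range M,
        ((L : ℝ) ^ 4 * ∑ t ∈ range L, ∑ t' ∈ range L,
      ‖∑ s ∈ range L, expe ((ω p.1 - ω p.2) * (s * ((t : ℝ) - t')))‖ ^ 2) := by
        gcongr with p _
        exact h2 p
    _ = (M : ℝ) ^ 6 * ((L : ℝ) ^ 4 * ∑ s ∈ range L, ∑ s' ∈ range L, ∑ t ∈ range L, ∑ t' ∈ range L,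
      ‖freqSum M ω (((s : ℝ) - s') * ((t : ℝ) - t'))‖ ^ 2) := by
        rw [← mul_sum, h3, card_product, card_range]
        push_cast
        ring
    _ ≤ _ := by
        gcongr
        exact sum_range_four_freqSum_le M N L hL ω

theorem QuasiRandom.exists_quadSum_le {δ ρ : ℝ} {ω : ℕ → ℝ} (hω : QuasiRandom δ ρ ω) :
    ∃ C : ℝ, 0 < C ∧ ∀ N : ℕ, 1 ≤ N → quadSum ⌊ρ * N⌋₊ N ω ≤ C * (N ^ 5 * (N : ℝ) ^ (-δ)) := by
  obtain ⟨C, hC, h⟩ := hω.2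
  refine ⟨C, hC, fun N hN => ?_⟩
  rw [quadSum_eq ρ ω N hN, mul_left_comm]
  gcongr
  exact h N hN

/-- Absorbs finitely many small `N` into the constant. -/
theorem one_le_mul_rpow_neg {A x γ : ℝ} (hx : 1 ≤ x) (hxA : x ≤ A) (hγ : 0 ≤ γ) :
    1 ≤ A ^ γ * x ^ (-γ) := by
  have hx0 : 0 < x := by linarith
  calc (1 : ℝ) = x ^ γ * x ^ (-γ) := by rw [← Real.rpow_add hx0]; simp
    _ ≤ _ := by gcongr

/-- The diagonal gives `N² M² ≤ C N^(5-δ)` with `M` of order `N`. Small `N`, where the floor may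
vanish, are absorbed by `(2 / ρ) ^ δ`. -/
theorem QuasiRandom.exists_inv_le {δ ρ : ℝ} (hρ : 0 < ρ) (hδ : 0 < δ) {ω : ℕ → ℝ}
    (hω : QuasiRandom δ ρ ω) :
    ∃ C : ℝ, 0 < C ∧ ∀ N : ℕ, 1 ≤ N → (N : ℝ)⁻¹ ≤ C * (N : ℝ) ^ (-δ) := by
  obtain ⟨C, hC, h⟩ := hω.exists_quadSum_le
  refine ⟨4 * C / ρ ^ 2 + (2 / ρ) ^ δ, by positivity, fun N hN => ?_⟩
  have hN1 : (1 : ℝ) ≤ N := by exact_mod_cast hN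
  have hN0 : (0 : ℝ) < N := by linarith
  have hpos : 0 < (N : ℝ) ^ (-δ) := Real.rpow_pos_of_pos hN0 _
  rw [add_mul]
  rcases le_total (N : ℝ) (2 / ρ) with hle | hle
  · have h1 := one_le_mul_rpow_neg hN1 hle hδ.le
    have h2 : (N : ℝ)⁻¹ ≤ 1 := inv_le_one_of_one_le₀ hN1
    have h3 : 0 ≤ 4 * C / ρ ^ 2 * (N : ℝ) ^ (-δ) := by positivity
    linarith
  · have hM : ρ * N / 2 ≤ (⌊ρ * N⌋₊ : ℝ) := by
      have := Nat.lt_floor_add_one (ρ * N)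
      rw [div_le_iff₀ hρ] at hle
      nlinarith
    have h1 : (N : ℝ) ^ 2 * (ρ * N / 2) ^ 2 ≤ C * (N ^ 5 * (N : ℝ) ^ (-δ)) :=
      le_trans (by gcongr) ((sq_mul_sq_le_quadSum ⌊ρ * N⌋₊ N ω).trans (h N hN))
    have h2 : (N : ℝ)⁻¹ ≤ 4 * C / ρ ^ 2 * (N : ℝ) ^ (-δ) := by
      rw [div_mul_eq_mul_div, le_div_iff₀ (by positivity), inv_mul_le_iff₀ hN0]
      refine le_of_mul_le_mul_left ?_ (by positivity : 0 < (N : ℝ) ^ 4)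
      nlinarith
    have h3 : 0 ≤ (2 / ρ) ^ δ * (N : ℝ) ^ (-δ) := by positivity
    linarith

/-- The phase sums are small in mean square along every polynomial of two variables whose mixed part
is `± s t`. -/
theorem QuasiRandom.exists_sum_freqSum_sq_le {δ ρ : ℝ} (hρ : 0 < ρ) (hδ : 0 < δ) {ω : ℕ → ℝ}
    (hω : QuasiRandom δ ρ ω) :
    ∃ C : ℝ, 0 < C ∧ ∀ N : ℕ, 1 ≤ N → ∃ L : ℕ, 1 ≤ L ∧ L ≤ N ∧
      ∀ (a b : ℕ → ℝ) (ε : ℝ), ε = 1 ∨ ε = -1 →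
        ∑ s ∈ range L, ∑ t ∈ range L, ‖freqSum ⌊ρ * N⌋₊ ω (a s + b t + ε * (s * t))‖ ^ 2 ≤
          C * (L ^ 2 * (N ^ 2 * (N : ℝ) ^ (-(δ / 4)))) := by
  obtain ⟨C, hC, h⟩ := hω.exists_quadSum_le
  refine ⟨1 + 1000 * ρ ^ 6 * C + ρ ^ 2 * 5 ^ (δ / 4), by positivity, fun N hN => ?_⟩
  have hN1 : (1 : ℝ) ≤ N := by exact_mod_cast hN
  have hN0 : (0 : ℝ) < N := by linarith
  have hM : (⌊ρ * N⌋₊ : ℝ) ≤ ρ * N := Nat.floor_le (by positivity)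
  have hpos : 0 < (N : ℝ) ^ (-(δ / 4)) := Real.rpow_pos_of_pos hN0 _
  have h5 : (0 : ℝ) < 5 ^ (δ / 4) := by positivity
  -- The side length is `L = N / 5`, or `L = 1` with the trivial bound when that quotient vanishes.
  rcases lt_or_ge N 5 with hN5 | hN5
  · refine ⟨1, le_rfl, hN, fun a b ε _ => ?_⟩
    have h1 := one_le_mul_rpow_neg (A := 5) (γ := δ / 4) hN1
      (by exact_mod_cast hN5.le) (by positivity)
    simp only [range_one, sum_singleton, Nat.cast_one, one_pow, one_mul]
    calc _ ≤ (ρ * N) ^ 2 := by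
          gcongr
          exact (norm_freqSum_le _ _ _).trans hM
      _ ≤ (ρ * N) ^ 2 * (5 ^ (δ / 4) * (N : ℝ) ^ (-(δ / 4))) :=
          le_mul_of_one_le_right (by positivity) h1
      _ = (ρ ^ 2 * 5 ^ (δ / 4)) * (N ^ 2 * (N : ℝ) ^ (-(δ / 4))) := by ring
      _ ≤ _ := by
          gcongr
          have : 0 ≤ 1000 * ρ ^ 6 * C := by positivity
          linarith
  · refine ⟨N / 5, by omega, by omega, fun a b ε hε => ?_⟩
    set L := N / 5 with hLdef
    have hNL : (N : ℝ) ≤ 10 * L := by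
      have : N ≤ 10 * L := by omega
      exact_mod_cast this
    have hL0 : (0 : ℝ) < L := by linarith
    set B := 1 + 1000 * ρ ^ 6 * C + ρ ^ 2 * 5 ^ (δ / 4) with hB
    have hB1 : 1 ≤ B := by
      have : 0 ≤ 1000 * ρ ^ 6 * C := by positivity
      have : 0 ≤ ρ ^ 2 * 5 ^ (δ / 4) := by positivity
      linarith
    have hB2 : 1000 * ρ ^ 6 * C ≤ B ^ 4 := by
      have h1 : B ≤ B ^ 4 := le_self_pow₀ hB1 (by norm_num)
      have : 0 ≤ ρ ^ 2 * 5 ^ (δ / 4) := by positivity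
      linarith
    have h4 : ((N : ℝ) ^ (-(δ / 4))) ^ 4 = (N : ℝ) ^ (-δ) := by
      rw [← Real.rpow_natCast, ← Real.rpow_mul hN0.le]
      congr 1
      push_cast
      ring
    refine le_of_pow_le_pow_left₀ (n := 4) (by norm_num) (by positivity) ?_
    calc _ ≤ (⌊ρ * N⌋₊ : ℝ) ^ 6 * ((L : ℝ) ^ 4 * (L * quadSum ⌊ρ * N⌋₊ N ω)) :=
          sum_freqSum_sq_pow_four_le _ N L (by omega) ω a b ε hε
      _ ≤ (ρ * N) ^ 6 * ((L : ℝ) ^ 4 * (L * (C * (N ^ 5 * (N : ℝ) ^ (-δ))))) := by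
          have := quadSum_nonneg ⌊ρ * N⌋₊ N ω
          gcongr
          exact h N hN
      _ = ρ ^ 6 * C * (L : ℝ) ^ 5 * N ^ 8 * (N : ℝ) ^ (-δ) * N ^ 3 := by ring
      -- Three factors `N` are traded for `10 * L` to complete `L ^ 8`; hence the constant 1000.
      _ ≤ ρ ^ 6 * C * (L : ℝ) ^ 5 * N ^ 8 * (N : ℝ) ^ (-δ) * (10 * L) ^ 3 := by gcongr
      _ = (1000 * ρ ^ 6 * C) * ((L : ℝ) ^ 8 * N ^ 8 * (N : ℝ) ^ (-δ)) := by ring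
      _ ≤ B ^ 4 * ((L : ℝ) ^ 8 * N ^ 8 * (N : ℝ) ^ (-δ)) := by gcongr
      _ = _ := by rw [← h4]; ring

end ExponentialSums

theorem apply_mem_ofFn {α : Type*} {n : ℕ} (c : Fin n → α) (l : Fin n) : c l ∈ List.ofFn c :=
  List.mem_ofFn.2 ⟨l, rfl⟩

theorem ofFn_eq_cons_cons {α : Type*} {n : ℕ} (c : Fin (n + 2) → α) :
    List.ofFn c = c 0 :: c 1 :: List.ofFn (Fin.tail (Fin.tail c)) := by
  rw [List.ofFn_succ, List.ofFn_succ]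
  rfl

theorem ofFn_tail_eq_cons {α : Type*} {n : ℕ} (c : Fin (n + 2) → α) :
    List.ofFn (Fin.tail c) = c 1 :: List.ofFn (Fin.tail (Fin.tail c)) := by
  rw [List.ofFn_succ]
  rfl

/-! ### Integer flows along a path and their number. -/

section Flows

variable {β γ R : Type*} [DecidableEq β] [DecidableEq γ]

/-- The divergence at `v` of the flow `a` along the path `c 0, c 1, …, c n`. -/
def pathDiv [Ring R] {n : ℕ} (c : Fin (n + 1) → β) (a : Fin n → R) (v : β) : R :=
  ∑ l : Fin n, a l * ((if c l.castSucc = v then 1 else 0) - (if c l.succ = v then 1 else 0))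

theorem pathDiv_succ [Ring R] {n : ℕ} (c : Fin (n + 2) → β) (a : Fin (n + 1) → R) (v : β) :
    pathDiv c a v = a 0 * ((if c 0 = v then 1 else 0) - (if c 1 = v then 1 else 0)) +
      pathDiv (Fin.tail c) (Fin.tail a) v := by
  rw [pathDiv, Fin.sum_univ_succ]
  rfl

theorem pathDiv_eq_zero [Ring R] {n : ℕ} (c : Fin (n + 1) → β) (a : Fin n → R) (v : β)
    (hv : ∀ l, c l ≠ v) : pathDiv c a v = 0 := by
  refine sum_eq_zero fun l _ => ?_
  rw [if_neg (hv _), if_neg (hv _), sub_zero, mul_zero]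

theorem pathDiv_comp [Ring R] {n : ℕ} (g : β → γ) (hg : Function.Injective g)
    (c : Fin (n + 1) → β) (a : Fin n → R) (v : β) : pathDiv (g ∘ c) a (g v) = pathDiv c a v := by
  simp [pathDiv, hg.eq_iff]

theorem sum_indicator_interval_telescope [Ring R] {n : ℕ} (F : Fin (n + 1) → R) (p q : Fin (n + 1))
    (hpq : p ≤ q) :
    ∑ l : Fin n, (if p ≤ l.castSucc ∧ l.castSucc < q then 1 else 0) * (F l.castSucc - F l.succ) =
      F p - F q := by
  induction n with
  | zero =>
    have : p = q := by omega
    simp [this]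
  | succ n ih =>
    rw [Fin.sum_univ_castSucc]
    rcases eq_or_ne q (Fin.last _) with rfl | hq
    · rcases eq_or_ne p (Fin.last _) with rfl | hp
      · rw [sub_self, sum_eq_zero, zero_add]
        · simp [Fin.last_le_iff, Fin.ext_iff]
        · intro l _
          rw [if_neg, zero_mul]
          rintro ⟨h1, h2⟩
          exact absurd h2 (not_lt.2 h1)
      · obtain ⟨p, rfl⟩ := Fin.exists_castSucc_eq.2 hp
        have := ih (fun l => F l.castSucc) p (Fin.last n) (Fin.le_last p)
        have e : ∀ l : Fin n, (if p.castSucc ≤ l.castSucc.castSucc ∧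
            l.castSucc.castSucc < Fin.last (n + 1) then (1 : R) else 0) =
            if p ≤ l.castSucc ∧ l.castSucc < Fin.last n then 1 else 0 := by
          intro l
          simp [Fin.castSucc_lt_last]
        simp only [e, ← Fin.castSucc_succ] at this ⊢
        rw [this, if_pos ⟨by simpa using Fin.le_last p, Fin.castSucc_lt_last _⟩]
        simp
    · obtain ⟨q, rfl⟩ := Fin.exists_castSucc_eq.2 hq
      have hp : p ≠ Fin.last _ := fun h => by
        subst h
        exact absurd (Fin.castSucc_lt_last q) (not_lt.2 hpq)
      obtain ⟨p, rfl⟩ := Fin.exists_castSucc_eq.2 hp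
      have := ih (fun l => F l.castSucc) p q (by simpa using hpq)
      simp only [Fin.castSucc_le_castSucc_iff, Fin.castSucc_lt_castSucc_iff, ← Fin.castSucc_succ]
        at this ⊢
      rw [this, if_neg, zero_mul, add_zero]
      exact fun h => absurd h.2 (not_lt.2 (Fin.le_last q))

/-- The unit flow on the stretch between positions `p` and `q` telescopes; it is a cycle when `c p =
c q`. -/
theorem pathDiv_indicator_interval [Ring R] {n : ℕ} (c : Fin (n + 1) → β) (p q : Fin (n + 1))
    (hpq : p ≤ q) (v : β) :
    pathDiv c (fun l => if p ≤ l.castSucc ∧ l.castSucc < q then (1 : R) else 0) v =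
      (if c p = v then 1 else 0) - (if c q = v then 1 else 0) :=
  sum_indicator_interval_telescope (fun l => if c l = v then (1 : R) else 0) p q hpq

/-- The flows in a box with a prescribed divergence. -/
noncomputable def boxFlows {n : ℕ} (box : Finset ℤ) (c : Fin (n + 1) → β) (d : β → ℤ) : Finset (Fin n → ℤ) := by
  classical
  exact (Fintype.piFinset fun _ => box).filter fun j => pathDiv c j = d

theorem mem_boxFlows {n : ℕ} {box : Finset ℤ} {c : Fin (n + 1) → β} {d : β → ℤ} {j : Fin n → ℤ} :
    j ∈ boxFlows box c d ↔ (∀ l, j l ∈ box) ∧ pathDiv c j = d := by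
  simp [boxFlows]

/-- The divergence of the flow remaining after the first edge of the path, which carries `g`. -/
def tailDiv {n : ℕ} (c : Fin (n + 2) → β) (d : β → ℤ) (g : ℤ) (v : β) : ℤ :=
  d v - g * ((if c 0 = v then 1 else 0) - (if c 1 = v then 1 else 0))

theorem mem_boxFlows_succ {n : ℕ} {box : Finset ℤ} {c : Fin (n + 2) → β} {d : β → ℤ}
    {j : Fin (n + 1) → ℤ} :
    j ∈ boxFlows box c d ↔
      j 0 ∈ box ∧ Fin.tail j ∈ boxFlows box (Fin.tail c) (tailDiv c d (j 0)) := by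
  rw [mem_boxFlows, mem_boxFlows, Fin.forall_fin_succ, and_assoc]
  refine and_congr_right fun _ => and_congr_right fun _ => ?_
  rw [funext_iff, funext_iff]
  refine forall_congr' fun v => ?_
  rw [pathDiv_succ, tailDiv, eq_sub_iff_add_eq, add_comm]

theorem card_boxFlows_succ {n : ℕ} (box : Finset ℤ) (c : Fin (n + 2) → β) (d : β → ℤ) :
    (boxFlows box c d).card =
      ∑ g ∈ box, (boxFlows box (Fin.tail c) (tailDiv c d g)).card := by
  classical
  rw [card_eq_sum_card_fiberwise (f := fun j => j 0) (t := box)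
    (fun j hj => (mem_boxFlows_succ.1 hj).1)]
  refine sum_congr rfl fun g hg => ?_
  refine card_nbij' (fun j => Fin.tail j) (fun j => Fin.cons g j) ?_ ?_ ?_ ?_
  · intro j hj
    simp only [coe_filter, Set.mem_ofPred_eq, mem_boxFlows_succ] at hj
    rw [← hj.2]
    exact hj.1.2
  · intro j hj
    simp only [coe_filter, Set.mem_ofPred_eq, mem_boxFlows_succ, Fin.cons_zero, Fin.tail_cons]
    exact ⟨⟨hg, hj⟩, trivial⟩
  · intro j hj
    simp only [coe_filter, Set.mem_ofPred_eq] at hj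
    simp only [← hj.2, Fin.cons_self_tail]
  · intro j hj
    simp

/-- If the path never returns to `c 0`, only the first edge meets it, so the divergence there
determines the value on that edge. -/
theorem tailDiv_eq_of_mem {n : ℕ} {box : Finset ℤ} {c : Fin (n + 2) → β} {d : β → ℤ} {g : ℤ}
    {j : Fin n → ℤ} (hc : ∀ l, Fin.tail c l ≠ c 0)
    (hj : j ∈ boxFlows box (Fin.tail c) (tailDiv c d g)) : g = d (c 0) := by
  have h1 := congrFun (mem_boxFlows.1 hj).2 (c 0)
  rw [pathDiv_eq_zero _ _ _ hc, tailDiv, if_pos rfl, if_neg (show c 1 ≠ c 0 from hc 0)] at h1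
  linarith

/-- Peel off the first edge: it has at most `box.card` values if `c 0` occurs again, and at most one
otherwise. The product form avoids subtraction of exponents. -/
theorem card_boxFlows_mul_le {n : ℕ} (box : Finset ℤ) (c : Fin (n + 1) → β) (d : β → ℤ) :
    (boxFlows box c d).card * box.card ^ (List.ofFn c).toFinset.card ≤ box.card ^ (n + 1) := by
  classical
  induction n generalizing d with
  | zero =>
    have h1 : (boxFlows box c d).card ≤ 1 := card_le_one.2 fun _ _ _ _ => Subsingleton.elim _ _
    simpa using Nat.mul_le_mul_right _ h1
  | succ n ih =>
    have hl : List.ofFn c = c 0 :: List.ofFn (Fin.tail c) := List.ofFn_succ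
    rw [hl, List.toFinset_cons, card_boxFlows_succ]
    by_cases hc : c 0 ∈ List.ofFn (Fin.tail c)
    · rw [insert_eq_of_mem (by simpa using hc), sum_mul]
      refine (sum_le_sum fun g _ => ih (Fin.tail c) (tailDiv c d g)).trans ?_
      rw [sum_const, smul_eq_mul, ← pow_succ']
    · rw [card_insert_of_notMem (by simpa using hc)]
      have hc' : ∀ l, Fin.tail c l ≠ c 0 := fun l h => hc (by rw [← h]; exact apply_mem_ofFn _ l)
      have h1 : ∑ g ∈ box, (boxFlows box (Fin.tail c) (tailDiv c d g)).card ≤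
          (boxFlows box (Fin.tail c) (tailDiv c d (d (c 0)))).card := by
        by_cases hd : d (c 0) ∈ box
        · rw [sum_eq_single_of_mem _ hd]
          intro g _ hg
          rw [card_eq_zero, eq_empty_iff_forall_notMem]
          exact fun j hj => hg (tailDiv_eq_of_mem hc' hj)
        · rw [sum_eq_zero]
          · exact Nat.zero_le _
          intro g hg
          rw [card_eq_zero, eq_empty_iff_forall_notMem]
          intro j hj
          exact hd (tailDiv_eq_of_mem hc' hj ▸ hg)
      calc _ ≤ (boxFlows box (Fin.tail c) (tailDiv c d (d (c 0)))).card *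
            box.card ^ ((List.ofFn (Fin.tail c)).toFinset.card + 1) := Nat.mul_le_mul_right _ h1
        _ = (boxFlows box (Fin.tail c) (tailDiv c d (d (c 0)))).card *
            box.card ^ ((List.ofFn (Fin.tail c)).toFinset.card) * box.card := by ring
        _ ≤ box.card ^ (n + 1) * box.card := Nat.mul_le_mul_right _ (ih _ _)
        _ = _ := by ring

/-- The divergence of the flow along the path `s` whose edge starting at `a` carries `F a`. -/
def listDiv [Ring R] : List β → (β → R) → β → R
  | a :: b :: s, F, v =>
    F a * ((if a = v then 1 else 0) - (if b = v then 1 else 0)) + listDiv (b :: s) F v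
  | _, _, _ => 0

theorem listDiv_congr [Ring R] (s : List β) (F G : β → R) (v : β) (h : ∀ a ∈ s, F a = G a) :
    listDiv s F v = listDiv s G v := by
  induction s with
  | nil => rfl
  | cons a s ih =>
    cases s with
    | nil => rfl
    | cons b s =>
      rw [listDiv, listDiv, h a (by simp), ih fun x hx => h x (List.mem_cons_of_mem _ hx)]

/-- A constant flow along the initial stretch telescopes to its two ends. -/
theorem listDiv_append [Ring R] (pre : List β) (a b : β) (rest : List β) (F : β → R) (g : R) (v : β)
    (hb : (pre ++ a :: rest).head? = some b) (h : ∀ b ∈ pre, F b = g) :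
    listDiv (pre ++ a :: rest) F v = g * ((if b = v then 1 else 0) -
      (if a = v then 1 else 0)) + listDiv (a :: rest) F v := by
  induction pre generalizing b with
  | nil =>
    obtain rfl : a = b := by simpa using hb
    simp
  | cons b' pre ih =>
    obtain rfl : b' = b := by simpa using hb
    cases pre with
    | nil => simp [listDiv, h b']
    | cons b'' pre =>
      have ih := ih b'' (by simp) fun x hx => h x (List.mem_cons_of_mem _ hx)
      rw [List.cons_append, List.cons_append, listDiv, ← List.cons_append, ih, h b' (by simp),
        ← add_assoc, ← mul_add, sub_add_sub_cancel]

theorem listDiv_eq_zero [Ring R] (s : List β) (F : β → R) (v : β) (hv : v ∉ s) :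
    listDiv s F v = 0 := by
  induction s with
  | nil => rfl
  | cons a s ih =>
    cases s with
    | nil => rfl
    | cons b s =>
      simp only [List.mem_cons, not_or] at hv
      rw [listDiv, ih (by simp [hv]), if_neg (Ne.symm hv.1), if_neg (Ne.symm hv.2.1)]
      simp

theorem listDiv_const [Ring R] (s : List β) (a b : β) (g : R) (v : β) (ha : s.head? = some a)
    (hb : s.getLast? = some b) :
    listDiv s (fun _ => g) v = g * ((if a = v then 1 else 0) - (if b = v then 1 else 0)) := by
  obtain ⟨pre, rfl⟩ := List.getLast?_eq_some_iff.1 hb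
  rw [listDiv_append pre b a [] _ g v ha fun _ _ => rfl, listDiv, add_zero]
  simp

/-- If a letter is prepended to a noncrossing word, then prescribing the flow along the new stack of
open blocks and along the new edge amounts to prescribing the flow along the old stack. -/
theorem listDiv_openStack_cons [Ring R] (a b : β) (w : List β)
    (hw : NoncrossingWord (a :: b :: w)) (ha : a ∈ b :: w) (F : β → R) (g : R) (v : β) :
    listDiv (openStack (a :: b :: w)) F v - g * ((if a = v then 1 else 0) - (if b = v then 1 else 0))
      = listDiv (openStack (b :: w))
        (fun x => if x ∈ openStack (a :: b :: w) then F x else g) v := by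
  obtain ⟨pre, rest, h1, h2, h3⟩ := openStack_cons_of_mem ha (hw.2 ha)
  obtain ⟨rest', h4⟩ := exists_openStack_cons b w hw.1
  have hnd := openStack_nodup (b :: w)
  rw [h1, List.nodup_append] at hnd
  rw [h3, h1, listDiv_append pre a b rest _ g v (by rw [← h1, h4, List.head?_cons]),
    listDiv_congr (a :: rest) (fun x => if x ∈ a :: rest then F x else g) F v
      fun x hx => if_pos hx]
  · rw [sub_eq_iff_eq_add, add_right_comm, ← mul_add]
    simp
  · intro x hx
    exact if_neg fun hx' => hnd.2.2 x hx x hx' rfl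

theorem listDiv_openStack_cons_of_notMem [Ring R] (a b : β) (w : List β)
    (hw : NoncrossingWord (a :: b :: w)) (ha : a ∉ b :: w) (F : β → R) (v : β) :
    listDiv (openStack (a :: b :: w)) F v =
      F a * ((if a = v then 1 else 0) - (if b = v then 1 else 0)) +
        listDiv (openStack (b :: w)) F v := by
  obtain ⟨rest', h4⟩ := exists_openStack_cons b w hw.1
  rw [openStack_cons_of_notMem ha, h4, listDiv]

/-- The divergence prescribed by the stack is peeled off edge by edge, and each step only copies
values: it never uses that `φ` is additive. This is why conservation of `j` implies conservation of
any function of `j`. -/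
theorem pathDiv_comp_of_noncrossing [Ring R] {n : ℕ} (c : Fin (n + 1) → β)
    (hc : NoncrossingWord (List.ofFn c)) (F : β → ℤ) (j : Fin n → ℤ)
    (hj : pathDiv c j = listDiv (openStack (List.ofFn c)) F) (φ : ℤ → R) :
    pathDiv c (fun l => φ (j l)) = listDiv (openStack (List.ofFn c)) (fun v => φ (F v)) := by
  induction n generalizing F with
  | zero =>
    funext v
    simp [pathDiv, openStack, listDiv]
  | succ n ih =>
    rw [ofFn_eq_cons_cons] at hc hj ⊢
    have htl : (fun l => φ (Fin.tail j l)) = Fin.tail fun l => φ (j l) := rfl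
    have ht : NoncrossingWord (List.ofFn (Fin.tail c)) := by
      rw [ofFn_tail_eq_cons]
      exact hc.1
    by_cases h0 : c 0 ∈ c 1 :: List.ofFn (Fin.tail (Fin.tail c))
    -- The first letter recurs: blocks that it closes receive the value `j 0` of the new edge, the
    -- others keep `F`.
    · have key := ih (Fin.tail c) ht
        (fun x => if x ∈ openStack (c 0 :: c 1 :: List.ofFn (Fin.tail (Fin.tail c))) then F x
          else j 0) (Fin.tail j) (by
        funext v
        rw [ofFn_tail_eq_cons, ← listDiv_openStack_cons _ _ _ hc h0, ← congrFun hj v, pathDiv_succ]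
        abel)
      funext v
      have key := congrFun key v
      simp only [apply_ite φ] at key
      rw [ofFn_tail_eq_cons, ← listDiv_openStack_cons _ _ _ hc h0 (fun x => φ (F x)) (φ (j 0)),
        eq_sub_iff_add_eq] at key
      rw [← key, pathDiv_succ, add_comm, htl]
    -- The first letter does not recur, so its edge is forced to carry the prescribed value.
    · have hF : j 0 = F (c 0) := by
        have h1 := congrFun hj (c 0)
        rw [pathDiv_succ, listDiv_openStack_cons_of_notMem _ _ _ hc h0, pathDiv_eq_zero,
          listDiv_eq_zero _ _ _ fun h => h0 ((openStack_sublist _).subset h), if_pos rfl,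
          if_neg fun h => h0 (by rw [← h]; simp)] at h1
        · simpa using h1
        · intro l hl
          refine h0 ?_
          rw [← ofFn_tail_eq_cons, ← hl]
          exact apply_mem_ofFn _ l
      have key := ih (Fin.tail c) ht F (Fin.tail j) (by
        funext v
        have h1 := congrFun hj v
        rw [pathDiv_succ, listDiv_openStack_cons_of_notMem _ _ _ hc h0, hF] at h1
        rw [ofFn_tail_eq_cons]
        exact add_left_cancel h1)
      funext v
      rw [pathDiv_succ, listDiv_openStack_cons_of_notMem _ _ _ hc h0, hF, ← htl, key,
        ofFn_tail_eq_cons]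

/-- Equality in `card_boxFlows_mul_le`: an edge to a recurring letter is entirely free, and a forced
value always lies in the box. -/
theorem card_boxFlows_of_noncrossing {n : ℕ} (box : Finset ℤ) (c : Fin (n + 1) → β)
    (hc : NoncrossingWord (List.ofFn c)) (F : β → ℤ) (hF : ∀ v, F v ∈ box) :
    (boxFlows box c (listDiv (openStack (List.ofFn c)) F)).card *
      box.card ^ (List.ofFn c).toFinset.card = box.card ^ (n + 1) := by
  classical
  induction n generalizing F with
  | zero =>
    have h1 : boxFlows box c (listDiv (openStack (List.ofFn c)) F) = {fun l => l.elim0} := by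
      ext j
      rw [mem_boxFlows, mem_singleton]
      refine ⟨fun _ => Subsingleton.elim _ _, fun _ => ⟨fun l => l.elim0, ?_⟩⟩
      funext v
      simp [pathDiv, openStack, listDiv]
    rw [h1]
    simp
  | succ n ih =>
    have ht : NoncrossingWord (List.ofFn (Fin.tail c)) := by
      rw [ofFn_eq_cons_cons] at hc
      rw [ofFn_tail_eq_cons]
      exact hc.1
    rw [card_boxFlows_succ]
    rw [ofFn_eq_cons_cons] at hc ⊢
    rw [List.toFinset_cons]
    by_cases h0 : c 0 ∈ c 1 :: List.ofFn (Fin.tail (Fin.tail c))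
    · rw [insert_eq_of_mem (by simpa using h0), sum_mul, pow_succ', ← smul_eq_mul, ← sum_const]
      refine sum_congr rfl fun g hg => ?_
      rw [← ih (Fin.tail c) ht
        (fun x => if x ∈ openStack (c 0 :: c 1 :: List.ofFn (Fin.tail (Fin.tail c))) then F x
          else g) (fun v => by split_ifs <;> simp [hF, hg]), ofFn_tail_eq_cons]
      congr 3
      funext v
      rw [← listDiv_openStack_cons _ _ _ hc h0, tailDiv]
    · rw [card_insert_of_notMem (by simpa using h0)]
      have hc' : ∀ l, Fin.tail c l ≠ c 0 := fun l h => h0 (by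
        rw [← ofFn_tail_eq_cons, ← h]; exact apply_mem_ofFn _ l)
      have h1 : listDiv (openStack (c 0 :: c 1 :: List.ofFn (Fin.tail (Fin.tail c)))) F (c 0) =
          F (c 0) := by
        rw [listDiv_openStack_cons_of_notMem _ _ _ hc h0,
          listDiv_eq_zero _ _ _ fun h => h0 ((openStack_sublist _).subset h), if_pos rfl,
          if_neg (show c 1 ≠ c 0 from hc' 0)]
        simp
      rw [sum_eq_single_of_mem _ (hF (c 0)), pow_succ, pow_succ, ← mul_assoc,
        ← ih (Fin.tail c) ht F hF, ofFn_tail_eq_cons]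
      · congr 4
        funext v
        rw [tailDiv, listDiv_openStack_cons_of_notMem _ _ _ hc h0]
        abel
      · intro g _ hg
        rw [card_eq_zero, eq_empty_iff_forall_notMem]
        exact fun j hj => hg ((tailDiv_eq_of_mem hc' hj).trans h1)

end Flows

/-! ### The contribution of a closed path: exact if noncrossing, small on average if crossing. -/

section ClosedSums

variable {β γ : Type} [DecidableEq β] [DecidableEq γ]

/-- The divergence that a flow along a path must have for the flow to be closed up by an edge
carrying `r` from the end to the start of the path. -/
def endDiv {R : Type*} [Ring R] {n : ℕ} (c : Fin (n + 1) → β) (r : R) (v : β) : R :=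
  r * ((if c 0 = v then 1 else 0) - (if c (Fin.last n) = v then 1 else 0))

/-- The coefficient `z (z - 1) / 2` of the frequency in the iterates of the skew-shift. -/
noncomputable def tri (z : ℤ) : ℝ := z * (z - 1) / 2

/-- The sum over the closed flows along a closed path with values in `1, …, N`, each of them having
the phase given by the frequencies `θ`. -/
noncomputable def closedSum [Fintype β] {n : ℕ} (N : ℕ) (c : Fin (n + 1) → β) (θ : β → ℝ) : ℂ :=
  ∑ f ∈ Icc (1 : ℤ) N, ∑ j ∈ boxFlows (Icc (1 : ℤ) N) c (endDiv c f),
    expe (∑ v, θ v * (pathDiv c (fun l => tri (j l)) v - endDiv c (tri f) v))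

theorem endDiv_comp {R : Type*} [Ring R] {n : ℕ} (g : β → γ) (hg : Function.Injective g)
    (c : Fin (n + 1) → β) (r : R) (v : β) : endDiv (g ∘ c) r (g v) = endDiv c r v := by
  simp [endDiv, hg.eq_iff]

theorem endDiv_eq_zero {R : Type*} [Ring R] {n : ℕ} (c : Fin (n + 1) → β) (r : R) (v : β)
    (hv : ∀ l, c l ≠ v) : endDiv c r v = 0 := by
  rw [endDiv, if_neg (hv _), if_neg (hv _), sub_zero, mul_zero]

/-- Unvisited labels have zero divergence, so an injective relabeling only pulls back the
frequencies. -/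
theorem closedSum_comp [Fintype β] [Fintype γ] {n : ℕ} (N : ℕ) (g : β → γ)
    (hg : Function.Injective g) (c : Fin (n + 1) → β) (θ : γ → ℝ) :
    closedSum N (g ∘ c) θ = closedSum N c (θ ∘ g) := by
  have hout : ∀ w, w ∉ Set.range g → ∀ l, (g ∘ c) l ≠ w := fun w hw l h => hw ⟨c l, h⟩
  refine sum_congr rfl fun f _ => ?_
  have hbox : boxFlows (Icc (1 : ℤ) N) (g ∘ c) (endDiv (g ∘ c) f) =
      boxFlows (Icc (1 : ℤ) N) c (endDiv c f) := by
    ext j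
    rw [mem_boxFlows, mem_boxFlows]
    refine and_congr_right fun _ => ⟨fun h => ?_, fun h => ?_⟩
    · funext v
      rw [← pathDiv_comp g hg, h, endDiv_comp g hg]
    · funext w
      by_cases hw : w ∈ Set.range g
      · obtain ⟨v, rfl⟩ := hw
        rw [pathDiv_comp g hg, h, endDiv_comp g hg]
      · rw [pathDiv_eq_zero _ _ _ (hout w hw), endDiv_eq_zero _ _ _ (hout w hw)]
  rw [hbox]
  refine sum_congr rfl fun j _ => ?_
  congr 1
  symm
  refine sum_of_injOn g hg.injOn (by simp) ?_ ?_
  · intro w _ hw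
    have hw' : w ∉ Set.range g := by simpa using hw
    rw [pathDiv_eq_zero _ _ _ (hout w hw'), endDiv_eq_zero _ _ _ (hout w hw'), sub_zero, mul_zero]
  · intro v _
    rw [pathDiv_comp g hg, endDiv_comp g hg, Function.comp_apply]

theorem card_Icc_one_int (N : ℕ) : (Icc (1 : ℤ) N).card = N := by simp

/-- The stack runs from the first letter of the word to the last, so a closing edge carrying `f`
prescribes the constant flow `f` along it. Then all phases vanish, and the circulations are counted
exactly for each `f`. -/
theorem closedSum_of_noncrossing [Fintype β] {n : ℕ} (N : ℕ) (c : Fin (n + 1) → β) (θ : β → ℝ)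
    (hc : NoncrossingWord (List.ofFn c)) :
    closedSum N c θ * (N : ℂ) ^ (List.ofFn c).toFinset.card = (N : ℂ) ^ (n + 2) := by
  have hhead : (openStack (List.ofFn c)).head? = some (c 0) := by
    rw [List.ofFn_succ] at hc ⊢
    obtain ⟨rest, h⟩ := exists_openStack_cons _ _ hc
    rw [h, List.head?_cons]
  have hlast : (openStack (List.ofFn c)).getLast? = some (c (Fin.last n)) := by
    rw [openStack_getLast? _ hc, List.ofFn_succ', List.concat_eq_append,
      List.getLast?_append]
    simp
  have hend : ∀ {R : Type} [Ring R] (r : R),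
      endDiv c r = listDiv (openStack (List.ofFn c)) fun _ => r := fun r => by
    funext v
    rw [listDiv_const _ _ _ _ _ hhead hlast, endDiv]
  rw [closedSum, sum_mul]
  have h : ∀ f ∈ Icc (1 : ℤ) N, (∑ j ∈ boxFlows (Icc (1 : ℤ) N) c (endDiv c f),
      expe (∑ v, θ v * (pathDiv c (fun l => tri (j l)) v - endDiv c (tri f) v))) *
      (N : ℂ) ^ (List.ofFn c).toFinset.card = (N : ℂ) ^ (n + 1) := by
    intro f hf
    have h1 : ∀ j ∈ boxFlows (Icc (1 : ℤ) N) c (endDiv c f),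
        expe (∑ v, θ v * (pathDiv c (fun l => tri (j l)) v - endDiv c (tri f) v)) = 1 := by
      intro j hj
      have h2 := (mem_boxFlows.1 hj).2
      rw [hend] at h2
      have h3 := pathDiv_comp_of_noncrossing c hc _ j h2 tri
      rw [← hend] at h3
      rw [h3, sum_eq_zero fun v _ => by rw [sub_self, mul_zero], expe_zero]
    have h4 := card_boxFlows_of_noncrossing (Icc (1 : ℤ) N) c hc (fun _ => f) fun _ => hf
    rw [← hend, card_Icc_one_int] at h4
    rw [sum_congr rfl h1, sum_const, nsmul_eq_mul, mul_one]
    exact_mod_cast h4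
  rw [sum_congr rfl h, sum_const, card_Icc_one_int, nsmul_eq_mul]
  ring

theorem norm_closedSum_mul_le [Fintype β] {n : ℕ} (N : ℕ) (c : Fin (n + 1) → β) (θ : β → ℝ) :
    ‖closedSum N c θ‖ * (N : ℝ) ^ (List.ofFn c).toFinset.card ≤ (N : ℝ) ^ (n + 2) := by
  have h : ‖closedSum N c θ‖ ≤
      ∑ f ∈ Icc (1 : ℤ) N, ((boxFlows (Icc (1 : ℤ) N) c (endDiv c f)).card : ℝ) := by
    refine (norm_sum_le _ _).trans (sum_le_sum fun f _ => (norm_sum_le _ _).trans ?_)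
    simp [norm_expe]
  calc _ ≤ (∑ f ∈ Icc (1 : ℤ) N, ((boxFlows (Icc (1 : ℤ) N) c (endDiv c f)).card : ℝ)) *
        (N : ℝ) ^ (List.ofFn c).toFinset.card := by gcongr
    _ = ∑ f ∈ Icc (1 : ℤ) N, ((boxFlows (Icc (1 : ℤ) N) c (endDiv c f)).card : ℝ) *
        (N : ℝ) ^ (List.ofFn c).toFinset.card := sum_mul _ _ _
    _ ≤ ∑ f ∈ Icc (1 : ℤ) N, (N : ℝ) ^ (n + 1) := sum_le_sum fun f _ => by
        have := card_boxFlows_mul_le (Icc (1 : ℤ) N) c (endDiv c f)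
        rw [card_Icc_one_int] at this
        exact_mod_cast this
    _ = _ := by
        rw [sum_const, card_Icc_one_int, nsmul_eq_mul]
        ring

/-- As `tri` is quadratic with leading coefficient 1/2, its mixed difference in two directions is
their product. -/
theorem pathDiv_tri_add {n : ℕ} (c : Fin (n + 1) → β) (j u w : Fin n → ℤ) (s t : ℤ) (v : β) :
    pathDiv c (fun l => tri (j l + s * u l + t * w l)) v =
      pathDiv c (fun l => tri (j l + s * u l)) v + (pathDiv c (fun l => tri (j l + t * w l)) v -
        pathDiv c (fun l => tri (j l)) v) + (pathDiv c (fun l => u l * w l) v : ℤ) * (s * t) := by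
  simp only [pathDiv, tri]
  push_cast
  rw [sum_mul, ← sum_sub_distrib, ← sum_add_distrib, ← sum_add_distrib]
  refine sum_congr rfl fun l _ => ?_
  ring

theorem pathDiv_add_mul_add_mul {n : ℕ} (c : Fin (n + 1) → β) (j u w : Fin n → ℤ) (s t : ℤ)
    (hu : pathDiv c u = 0) (hw : pathDiv c w = 0) :
    pathDiv c (fun l => j l - s * u l - t * w l) = pathDiv c j := by
  funext v
  have h1 := congrFun hu v
  have h2 := congrFun hw v
  simp only [pathDiv, Pi.zero_apply] at h1 h2 ⊢
  calc _ = ∑ l, j l * ((if c l.castSucc = v then 1 else 0) - (if c l.succ = v then 1 else 0)) -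
        s * ∑ l, u l * ((if c l.castSucc = v then 1 else 0) - (if c l.succ = v then 1 else 0)) -
        t * ∑ l, w l * ((if c l.castSucc = v then 1 else 0) - (if c l.succ = v then 1 else 0)) := by
        rw [mul_sum, mul_sum, ← sum_sub_distrib, ← sum_sub_distrib]
        exact sum_congr rfl fun l _ => by ring
    _ = _ := by rw [h1, h2]; ring

/-- A sum over flows is bounded by a sum over flows in a larger box, shifted by two cycles. -/
theorem sum_boxFlows_le_sum_shift {n : ℕ} (c : Fin (n + 1) → β) (d : β → ℤ) (u w : Fin n → ℤ)
    (hu : pathDiv c u = 0) (hw : pathDiv c w = 0) (hu1 : ∀ l, u l = 0 ∨ u l = 1)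
    (hw1 : ∀ l, w l = 0 ∨ w l = 1) (N s t : ℕ) (hs : s ≤ N) (ht : t ≤ N)
    (F : (Fin n → ℤ) → ℝ) (hF : ∀ j, 0 ≤ F j) :
    ∑ j ∈ boxFlows (Icc (1 : ℤ) N) c d, F j ≤
      ∑ j ∈ boxFlows (Icc (-(2 * N) : ℤ) N) c d, F (fun l => j l + s * u l + t * w l) := by
  set e : (Fin n → ℤ) → (Fin n → ℤ) := fun j l => j l - s * u l - t * w l with he
  have h1 : ∑ j ∈ boxFlows (Icc (1 : ℤ) N) c d, F j =
      ∑ j ∈ (boxFlows (Icc (1 : ℤ) N) c d).image e, F (fun l => j l + s * u l + t * w l) := by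
    rw [sum_image]
    · refine sum_congr rfl fun j _ => ?_
      congr 1
      funext l
      simp only [he]
      ring
    · intro j _ j' _ h
      funext l
      have := congrFun h l
      simp only [he] at this
      linarith
  rw [h1]
  refine sum_le_sum_of_subset_of_nonneg ?_ fun j _ _ => hF _
  -- Undoing the shift subtracts at most `s + t ≤ 2 * N` from entries in `1, …, N`.
  intro j' hj'
  obtain ⟨j, hj, rfl⟩ := mem_image.1 hj'
  rw [mem_boxFlows] at hj ⊢
  refine ⟨fun l => ?_, by rw [he, pathDiv_add_mul_add_mul c j u w s t hu hw, hj.2]⟩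
  have := hj.1 l
  rw [mem_Icc] at this ⊢
  simp only [he]
  rcases hu1 l with h | h <;> rcases hw1 l with h' | h' <;> rw [h, h'] <;>
    constructor <;> omega

variable {δ ρ : ℝ} {ω : ℕ → ℝ}

/-- Average over all shifts by `s u + t w`, `s, t < L`, of the flow along the two cycles of the
crossing. For each base flow the argument of `freqSum` at `c p₁` has the form `a(s) + b(t) - s t`,
to which the quasi-random estimate applies. -/
theorem QuasiRandom.exists_sum_boxFlows_sq_le (hω : QuasiRandom δ ρ ω) (hρ : 0 < ρ) (hδ : 0 < δ)
    (n : ℕ) :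
    ∃ C : ℝ, 0 < C ∧ ∀ (N : ℕ), 1 ≤ N → ∀ {β : Type} [DecidableEq β] (c : Fin (n + 1) → β)
      (p₁ p₂ p₃ p₄ : Fin (n + 1)), p₁ < p₂ → p₂ < p₃ → p₃ < p₄ → c p₁ = c p₃ → c p₂ = c p₄ →
      c p₁ ≠ c p₂ → ∀ (d : β → ℤ) (κ : ℝ),
      (∑ j ∈ boxFlows (Icc (1 : ℤ) N) c d,
        ‖freqSum ⌊ρ * N⌋₊ ω (pathDiv c (fun l => tri (j l)) (c p₁) - κ)‖ ^ 2) *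
        (N : ℝ) ^ (List.ofFn c).toFinset.card ≤
        C * (N ^ (n + 1) * (N ^ 2 * (N : ℝ) ^ (-(δ / 4)))) := by
  obtain ⟨C, hC, h⟩ := hω.exists_sum_freqSum_sq_le hρ hδ
  refine ⟨4 ^ (n + 1) * C, by positivity, ?_⟩
  intro N hN β _ c p₁ p₂ p₃ p₄ h12 h23 h34 h13 h24 hne d κ
  obtain ⟨L, hL, hLN, hY⟩ := h N hN
  have hN1 : (1 : ℝ) ≤ N := by exact_mod_cast hN
  have hL0 : (0 : ℝ) < L := by exact_mod_cast hL
  set u : Fin n → ℤ := fun l => if p₁ ≤ l.castSucc ∧ l.castSucc < p₃ then 1 else 0 with hu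
  set w : Fin n → ℤ := fun l => if p₂ ≤ l.castSucc ∧ l.castSucc < p₄ then 1 else 0 with hw
  have hdu : pathDiv c u = 0 := by
    funext v
    rw [hu, pathDiv_indicator_interval c p₁ p₃ (h12.trans h23).le, h13, sub_self, Pi.zero_apply]
  have hdw : pathDiv c w = 0 := by
    funext v
    rw [hw, pathDiv_indicator_interval c p₂ p₄ (h23.trans h34).le, h24, sub_self, Pi.zero_apply]
  -- The cycles overlap on the stretch from `p₂` to `p₃`, which leaves `b` and arrives at `a`; this
  -- is where the crossing enters.
  have hduw : pathDiv c (fun l => u l * w l) (c p₁) = -1 := by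
    have e : (fun l => u l * w l) =
        fun l : Fin n => if p₂ ≤ l.castSucc ∧ l.castSucc < p₃ then (1 : ℤ) else 0 := by
      funext l
      simp only [hu, hw, ← ite_and, mul_ite, mul_one, mul_zero]
      refine if_congr ⟨fun h => ⟨h.1.1, h.2.2⟩, fun h => ⟨⟨h.1, h.2.trans h34⟩,
        h12.le.trans h.1, h.2⟩⟩ rfl rfl
    rw [e, pathDiv_indicator_interval c p₂ p₃ h23.le, if_neg hne.symm, if_pos h13.symm]
    rfl
  set F : (Fin n → ℤ) → ℝ := fun j =>
    ‖freqSum ⌊ρ * N⌋₊ ω (pathDiv c (fun l => tri (j l)) (c p₁) - κ)‖ ^ 2 with hF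
  set A := boxFlows (Icc (1 : ℤ) N) c d
  set B := boxFlows (Icc (-(2 * N) : ℤ) N) c d
  have h1 : (L : ℝ) ^ 2 * ∑ j ∈ A, F j ≤
      B.card * (C * (L ^ 2 * (N ^ 2 * (N : ℝ) ^ (-(δ / 4))))) := by
    calc (L : ℝ) ^ 2 * ∑ j ∈ A, F j = ∑ s ∈ range L, ∑ t ∈ range L, ∑ j ∈ A, F j := by
          simp only [sum_const, card_range, nsmul_eq_mul]
          ring
      _ ≤ ∑ s ∈ range L, ∑ t ∈ range L, ∑ j ∈ B, F (fun l => j l + s * u l + t * w l) := by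
          refine sum_le_sum fun s hs => sum_le_sum fun t ht => ?_
          rw [mem_range] at hs ht
          refine sum_boxFlows_le_sum_shift c d u w hdu hdw ?_ ?_ N s t (by omega) (by omega) F
            fun j => by positivity
          · intro l
            simp only [hu]
            split_ifs <;> simp
          · intro l
            simp only [hw]
            split_ifs <;> simp
      _ = ∑ j ∈ B, ∑ s ∈ range L, ∑ t ∈ range L, F (fun l => j l + s * u l + t * w l) :=
          (sum_comm_three _ _ _ _).symm
      _ ≤ ∑ j ∈ B, C * (L ^ 2 * (N ^ 2 * (N : ℝ) ^ (-(δ / 4)))) := by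
          refine sum_le_sum fun j _ => ?_
          refine le_of_eq_of_le ?_ (hY
            (fun s => pathDiv c (fun l => tri (j l + s * u l)) (c p₁) - κ)
            (fun t => pathDiv c (fun l => tri (j l + t * w l)) (c p₁) -
              pathDiv c (fun l => tri (j l)) (c p₁)) (-1) (Or.inr rfl))
          refine sum_congr rfl fun s _ => sum_congr rfl fun t _ => ?_
          simp only [hF]
          rw [pathDiv_tri_add c j u w s t, hduw]
          congr 3
          push_cast
          ring
      _ = _ := by rw [sum_const, nsmul_eq_mul]
  -- The enlarged box has `3 * N + 1 ≤ 4 * N` elements, whence the factor `4 ^ (n + 1)`.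
  have h2 : (B.card : ℝ) * (N : ℝ) ^ (List.ofFn c).toFinset.card ≤ (4 * N) ^ (n + 1) := by
    have h3 := card_boxFlows_mul_le (Icc (-(2 * N) : ℤ) N) c d
    have h4 : (Icc (-(2 * N) : ℤ) N).card = 3 * N + 1 := by
      rw [Int.card_Icc]
      omega
    rw [h4] at h3
    have h5 : B.card * N ^ (List.ofFn c).toFinset.card ≤ (4 * N) ^ (n + 1) :=
      (Nat.mul_le_mul_left _ (Nat.pow_le_pow_left (by omega) _)).trans
        (h3.trans (Nat.pow_le_pow_left (by omega) _))
    exact_mod_cast h5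
  have hpos : 0 < (N : ℝ) ^ (-(δ / 4)) := Real.rpow_pos_of_pos (by linarith) _
  refine le_of_mul_le_mul_left ?_ (by positivity : 0 < (L : ℝ) ^ 2)
  calc _ = ((L : ℝ) ^ 2 * ∑ j ∈ A, F j) * (N : ℝ) ^ (List.ofFn c).toFinset.card := by ring
    _ ≤ (B.card * (C * (L ^ 2 * (N ^ 2 * (N : ℝ) ^ (-(δ / 4)))))) *
        (N : ℝ) ^ (List.ofFn c).toFinset.card := by gcongr
    _ = (B.card * (N : ℝ) ^ (List.ofFn c).toFinset.card) *
        (C * (L ^ 2 * (N ^ 2 * (N : ℝ) ^ (-(δ / 4))))) := by ring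
    _ ≤ (4 * N) ^ (n + 1) * (C * (L ^ 2 * (N ^ 2 * (N : ℝ) ^ (-(δ / 4))))) := by gcongr
    _ = _ := by rw [mul_pow]; ring

/-- Cauchy-Schwarz against the number of flows halves the saving from `δ / 4` to `δ / 8`. -/
theorem QuasiRandom.exists_sum_boxFlows_le (hω : QuasiRandom δ ρ ω) (hρ : 0 < ρ) (hδ : 0 < δ)
    (n : ℕ) :
    ∃ C : ℝ, 0 < C ∧ ∀ (N : ℕ), 1 ≤ N → ∀ {β : Type} [DecidableEq β] (c : Fin (n + 1) → β)
      (p₁ p₂ p₃ p₄ : Fin (n + 1)), p₁ < p₂ → p₂ < p₃ → p₃ < p₄ → c p₁ = c p₃ → c p₂ = c p₄ →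
      c p₁ ≠ c p₂ → ∀ (d : β → ℤ) (κ : ℝ),
      (∑ j ∈ boxFlows (Icc (1 : ℤ) N) c d,
        ‖freqSum ⌊ρ * N⌋₊ ω (pathDiv c (fun l => tri (j l)) (c p₁) - κ)‖) *
        (N : ℝ) ^ (List.ofFn c).toFinset.card ≤
        C * (N ^ (n + 2) * (N : ℝ) ^ (-(δ / 8))) := by
  obtain ⟨C, hC, h⟩ := hω.exists_sum_boxFlows_sq_le hρ hδ n
  refine ⟨Real.sqrt C, Real.sqrt_pos.2 hC, ?_⟩
  intro N hN β _ c p₁ p₂ p₃ p₄ h12 h23 h34 h13 h24 hne d κ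
  have h1 := h N hN c p₁ p₂ p₃ p₄ h12 h23 h34 h13 h24 hne d κ
  have hN0 : (0 : ℝ) < N := by exact_mod_cast hN
  have h2 := card_boxFlows_mul_le (Icc (1 : ℤ) N) c d
  rw [card_Icc_one_int] at h2
  have h2' : ((boxFlows (Icc (1 : ℤ) N) c d).card : ℝ) * (N : ℝ) ^ (List.ofFn c).toFinset.card ≤
      (N : ℝ) ^ (n + 1) := by exact_mod_cast h2
  have h3 := sq_sum_le_card_mul_sum_sq (s := boxFlows (Icc (1 : ℤ) N) c d)
    (f := fun j => ‖freqSum ⌊ρ * N⌋₊ ω (pathDiv c (fun l => tri (j l)) (c p₁) - κ)‖)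
  have h4 : ((N : ℝ) ^ (-(δ / 8))) ^ 2 = (N : ℝ) ^ (-(δ / 4)) := by
    rw [← Real.rpow_natCast, ← Real.rpow_mul hN0.le]
    congr 1
    push_cast
    ring
  refine le_of_pow_le_pow_left₀ (n := 2) (by norm_num) (by positivity) ?_
  calc _ = (∑ j ∈ boxFlows (Icc (1 : ℤ) N) c d,
        ‖freqSum ⌊ρ * N⌋₊ ω (pathDiv c (fun l => tri (j l)) (c p₁) - κ)‖) ^ 2 *
        ((N : ℝ) ^ (List.ofFn c).toFinset.card) ^ 2 := by ring
    _ ≤ ((boxFlows (Icc (1 : ℤ) N) c d).card * ∑ j ∈ boxFlows (Icc (1 : ℤ) N) c d,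
        ‖freqSum ⌊ρ * N⌋₊ ω (pathDiv c (fun l => tri (j l)) (c p₁) - κ)‖ ^ 2) *
        ((N : ℝ) ^ (List.ofFn c).toFinset.card) ^ 2 := by gcongr
    _ = ((boxFlows (Icc (1 : ℤ) N) c d).card * (N : ℝ) ^ (List.ofFn c).toFinset.card) *
        ((∑ j ∈ boxFlows (Icc (1 : ℤ) N) c d,
        ‖freqSum ⌊ρ * N⌋₊ ω (pathDiv c (fun l => tri (j l)) (c p₁) - κ)‖ ^ 2) *
        (N : ℝ) ^ (List.ofFn c).toFinset.card) := by ring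
    _ ≤ (N : ℝ) ^ (n + 1) * (C * (N ^ (n + 1) * (N ^ 2 * (N : ℝ) ^ (-(δ / 4))))) := by gcongr
    _ = _ := by
        rw [mul_pow, Real.sq_sqrt hC.le, mul_pow, h4]
        ring

/-- Without the injectivity constraint the blocks are labelled independently, so the sum factors
over them. -/
theorem sum_closedSum_eq [Fintype β] {n : ℕ} (M N : ℕ) (ω : ℕ → ℝ) (c : Fin (n + 1) → β) :
    ∑ g : β → Fin M, closedSum N c (fun v => ω (g v)) =
      ∑ f ∈ Icc (1 : ℤ) N, ∑ j ∈ boxFlows (Icc (1 : ℤ) N) c (endDiv c f),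
        ∏ v, freqSum M ω (pathDiv c (fun l => tri (j l)) v - endDiv c (tri f) v) := by
  simp only [closedSum]
  rw [sum_comm]
  refine sum_congr rfl fun f _ => ?_
  rw [sum_comm]
  refine sum_congr rfl fun j _ => ?_
  simp only [expe_sum, freqSum, sum_range]
  rw [prod_univ_sum, Fintype.piFinset_univ]

theorem card_toFinset_ofFn_of_surjective [Fintype β] {n : ℕ} (c : Fin n → β)
    (hc : Function.Surjective c) : (List.ofFn c).toFinset.card = Fintype.card β := by
  rw [← card_univ]
  congr 1
  ext v
  obtain ⟨l, rfl⟩ := hc v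
  exact iff_of_true (List.mem_toFinset.2 (apply_mem_ofFn c l)) (mem_univ _)

/-- The sum over all labelings of a crossing partition. -/
theorem QuasiRandom.exists_norm_sum_closedSum_le (hω : QuasiRandom δ ρ ω) (hρ : 0 < ρ)
    (hδ : 0 < δ) (n : ℕ) :
    ∃ C : ℝ, 0 < C ∧ ∀ (N : ℕ), 1 ≤ N → ∀ {β : Type} [DecidableEq β] [Fintype β]
      (c : Fin (n + 1) → β), Function.Surjective c → ¬ NoncrossingWord (List.ofFn c) →
      ‖∑ g : β → Fin ⌊ρ * N⌋₊, closedSum N c (fun v => ω (g v))‖ ≤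
        C * (N ^ (n + 2) * (N : ℝ) ^ (-(δ / 8))) := by
  obtain ⟨C, hC, h⟩ := hω.exists_sum_boxFlows_le hρ hδ n
  refine ⟨(1 + ρ) ^ (n + 1) * C, by positivity, ?_⟩
  intro N hN β _ _ c hcs hc
  obtain ⟨p₁, p₂, p₃, p₄, h12, h23, h34, h13, h24, hne⟩ := exists_crossing c hc
  have hN0 : (0 : ℝ) < N := by exact_mod_cast hN
  have hpos : 0 < (N : ℝ) ^ (-(δ / 8)) := Real.rpow_pos_of_pos (by linarith) _
  have hM : (⌊ρ * N⌋₊ : ℝ) ≤ ρ * N := Nat.floor_le (by positivity)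
  set M := ⌊ρ * N⌋₊
  have hcard := card_toFinset_ofFn_of_surjective c hcs
  obtain ⟨b, hb⟩ : ∃ b, Fintype.card β = b + 1 :=
    Nat.exists_eq_succ_of_ne_zero (Fintype.card_pos_iff.2 ⟨c 0⟩).ne'
  have hbn : b ≤ n := by
    have := Fintype.card_le_of_surjective c hcs
    rw [Fintype.card_fin] at this
    omega
  -- Only the block of `c p₁` yields cancellation; every other factor is bounded by `M`.
  have hprod : ∀ q : β → ℝ, ‖∏ v, freqSum M ω (q v)‖ ≤
      (M : ℝ) ^ b * ‖freqSum M ω (q (c p₁))‖ := by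
    intro q
    rw [norm_prod, ← mul_prod_erase univ _ (mem_univ (c p₁)), mul_comm]
    gcongr
    refine (prod_le_prod (fun _ _ => norm_nonneg _) fun v _ => norm_freqSum_le M ω (q v)).trans ?_
    rw [prod_const, card_erase_of_mem (mem_univ _), card_univ, hb, Nat.add_sub_cancel]
  refine le_of_mul_le_mul_right ?_ (by positivity : 0 < (N : ℝ) ^ (b + 1))
  rw [sum_closedSum_eq]
  calc _ ≤ (∑ f ∈ Icc (1 : ℤ) N, ∑ j ∈ boxFlows (Icc (1 : ℤ) N) c (endDiv c f), (M : ℝ) ^ b *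
        ‖freqSum M ω (pathDiv c (fun l => tri (j l)) (c p₁) - endDiv c (tri f) (c p₁))‖) *
        (N : ℝ) ^ (b + 1) := by
        gcongr
        refine (norm_sum_le _ _).trans (sum_le_sum fun f _ => (norm_sum_le _ _).trans
          (sum_le_sum fun j _ => ?_))
        exact hprod fun v => pathDiv c (fun l => tri (j l)) v - endDiv c (tri f) v
    _ = ∑ f ∈ Icc (1 : ℤ) N, (M : ℝ) ^ b * ((∑ j ∈ boxFlows (Icc (1 : ℤ) N) c (endDiv c f),
        ‖freqSum M ω (pathDiv c (fun l => tri (j l)) (c p₁) - endDiv c (tri f) (c p₁))‖) *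
        (N : ℝ) ^ (b + 1)) := by
        rw [sum_mul]
        simp only [← mul_sum, mul_assoc]
    _ ≤ ∑ f ∈ Icc (1 : ℤ) N, (M : ℝ) ^ b * (C * (N ^ (n + 2) * (N : ℝ) ^ (-(δ / 8)))) := by
        refine sum_le_sum fun f _ => mul_le_mul_of_nonneg_left ?_ (by positivity)
        rw [← hb, ← hcard]
        exact h N hN c p₁ p₂ p₃ p₄ h12 h23 h34 h13 h24 hne _ _
    _ = N * ((M : ℝ) ^ b * (C * (N ^ (n + 2) * (N : ℝ) ^ (-(δ / 8))))) := by
        rw [sum_const, card_Icc_one_int, nsmul_eq_mul]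
    _ ≤ N * (((1 + ρ) ^ (n + 1) * (N : ℝ) ^ b) * (C * (N ^ (n + 2) * (N : ℝ) ^ (-(δ / 8))))) := by
        gcongr
        calc (M : ℝ) ^ b ≤ (ρ * N) ^ b := by gcongr
          _ = ρ ^ b * N ^ b := mul_pow _ _ _
          _ ≤ (1 + ρ) ^ (n + 1) * N ^ b := by
            gcongr
            calc ρ ^ b ≤ (1 + ρ) ^ b := by gcongr; linarith
              _ ≤ (1 + ρ) ^ (n + 1) := pow_le_pow_right₀ (by linarith) (by omega)
    _ = _ := by ring

/-- For each pair of blocks with a common label, one of the two labels is redundant. -/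
theorem card_not_injective_le (β : Type) [Fintype β] [DecidableEq β] (b M : ℕ)
    (hb : Fintype.card β = b + 1) :
    (univ.filter fun g : β → Fin M => ¬ Function.Injective g).card ≤ (b + 1) ^ 2 * M ^ b := by
  classical
  have h1 : (univ.filter fun g : β → Fin M => ¬ Function.Injective g) ⊆
      (univ : Finset (β × β)).biUnion fun p =>
        univ.filter fun g : β → Fin M => g p.1 = g p.2 ∧ p.1 ≠ p.2 := by
    intro g hg
    simp only [mem_filter, mem_univ, true_and, Function.Injective, not_forall] at hg
    obtain ⟨x, y, hxy, hne⟩ := hg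
    simp only [mem_biUnion, mem_filter, mem_univ, true_and]
    exact ⟨(x, y), hxy, hne⟩
  refine (card_le_card h1).trans ?_
  have h2 : ∀ p ∈ (univ : Finset (β × β)),
      (univ.filter fun g : β → Fin M => g p.1 = g p.2 ∧ p.1 ≠ p.2).card ≤ M ^ b := by
    rintro ⟨x, y⟩ -
    have h3 : M ^ b = (univ : Finset ({z : β // z ≠ x} → Fin M)).card := by
      rw [card_univ, Fintype.card_fun, Fintype.card_fin, Fintype.card_subtype_compl,
        Fintype.card_subtype_eq, hb, Nat.add_sub_cancel]
    rw [h3]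
    refine card_le_card_of_injOn (fun g z => g z) (by simp) ?_
    intro g hg g' hg' h
    simp only [coe_filter, mem_univ, true_and, Set.mem_ofPred_eq] at hg hg'
    have h4 : ∀ z, z ≠ x → g z = g' z := fun z hz => congrFun h ⟨z, hz⟩
    funext z
    by_cases hz : z = x
    · rw [hz, hg.1, hg'.1, h4 y (Ne.symm hg.2)]
    · exact h4 z hz
  refine (card_biUnion_le_card_mul _ _ _ h2).trans (le_of_eq ?_)
  rw [card_univ, Fintype.card_prod, hb, sq]

/-- The sum over the injective labelings of a crossing partition. -/
theorem QuasiRandom.exists_norm_sum_embedding_closedSum_le (hω : QuasiRandom δ ρ ω) (hρ : 0 < ρ)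
    (hδ : 0 < δ) (n : ℕ) :
    ∃ C : ℝ, 0 < C ∧ ∀ (N : ℕ), 1 ≤ N → ∀ {β : Type} [DecidableEq β] [Fintype β]
      (c : Fin (n + 1) → β), Function.Surjective c → ¬ NoncrossingWord (List.ofFn c) →
      ‖∑ g : β ↪ Fin ⌊ρ * N⌋₊, closedSum N c (fun v => ω (g v))‖ ≤
        C * (N ^ (n + 2) * (N : ℝ) ^ (-(δ / 16))) := by
  classical
  obtain ⟨C₁, hC₁, h₁⟩ := hω.exists_norm_sum_closedSum_le hρ hδ n
  obtain ⟨C₂, hC₂, h₂⟩ := hω.exists_inv_le hρ hδ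
  refine ⟨C₁ + (n + 1) ^ 2 * (1 + ρ) ^ n * C₂, by positivity, ?_⟩
  intro N hN β _ _ c hcs hc
  have hN1 : (1 : ℝ) ≤ N := by exact_mod_cast hN
  have hN0 : (0 : ℝ) < N := by linarith
  have hM : (⌊ρ * N⌋₊ : ℝ) ≤ ρ * N := Nat.floor_le (by positivity)
  have h3 := h₁ N hN c hcs hc
  set M := ⌊ρ * N⌋₊
  have hcard := card_toFinset_ofFn_of_surjective c hcs
  obtain ⟨b, hb⟩ : ∃ b, Fintype.card β = b + 1 :=
    Nat.exists_eq_succ_of_ne_zero (Fintype.card_pos_iff.2 ⟨c 0⟩).ne'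
  have hbn : b ≤ n := by
    have := Fintype.card_le_of_surjective c hcs
    rw [Fintype.card_fin] at this
    omega
  have h4 : ∑ g : β ↪ Fin M, closedSum N c (fun v => ω (g v)) =
      ∑ g ∈ univ.filter (fun g : β → Fin M => Function.Injective g),
        closedSum N c (fun v => ω (g v)) := by
    refine sum_bij (fun g _ => g) (fun g _ => by simpa using g.injective)
      (fun g _ g' _ h => DFunLike.coe_injective h) (fun g hg => ⟨⟨g, by simpa using hg⟩, by simp⟩)
      fun g _ => rfl
  have h5 := sum_filter_add_sum_filter_not univ (fun g : β → Fin M => Function.Injective g)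
    fun g => closedSum N c (fun v => ω (g v))
  have h6 : ‖∑ g ∈ univ.filter (fun g : β → Fin M => ¬ Function.Injective g),
      closedSum N c (fun v => ω (g v))‖ ≤ (n + 1) ^ 2 * (1 + ρ) ^ n * (N ^ (n + 2) * (N : ℝ)⁻¹) := by
    refine le_of_mul_le_mul_right ?_ (by positivity : 0 < (N : ℝ) ^ (b + 1))
    calc _ ≤ (∑ g ∈ univ.filter (fun g : β → Fin M => ¬ Function.Injective g),
          ‖closedSum N c (fun v => ω (g v))‖) * (N : ℝ) ^ (b + 1) := by
          gcongr
          exact norm_sum_le _ _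
      _ ≤ ∑ g ∈ univ.filter (fun g : β → Fin M => ¬ Function.Injective g), (N : ℝ) ^ (n + 2) := by
          rw [sum_mul]
          refine sum_le_sum fun g _ => ?_
          rw [← hb, ← hcard]
          exact norm_closedSum_mul_le N c _
      _ = ((univ.filter fun g : β → Fin M => ¬ Function.Injective g).card : ℝ) *
          (N : ℝ) ^ (n + 2) := by rw [sum_const, nsmul_eq_mul]
      _ ≤ ((b + 1) ^ 2 * M ^ b) * (N : ℝ) ^ (n + 2) := by
          gcongr
          exact_mod_cast card_not_injective_le β b M hb
      _ ≤ ((n + 1) ^ 2 * ((1 + ρ) ^ n * N ^ b)) * (N : ℝ) ^ (n + 2) := by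
          gcongr
          calc (M : ℝ) ^ b ≤ (ρ * N) ^ b := by gcongr
            _ = ρ ^ b * N ^ b := mul_pow _ _ _
            _ ≤ (1 + ρ) ^ n * N ^ b := by
              gcongr
              calc ρ ^ b ≤ (1 + ρ) ^ b := by gcongr; linarith
                _ ≤ (1 + ρ) ^ n := pow_le_pow_right₀ (by linarith) hbn
      _ = _ := by
          field_simp
          ring
  -- The sum over all labelings saves `N^(-δ/8)` and the coincidences save `N⁻¹ = O(N^(-δ))`; both
  -- are relaxed to `N^(-δ/16)`.
  have h7 : (N : ℝ) ^ (-(δ / 8)) ≤ (N : ℝ) ^ (-(δ / 16)) :=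
    Real.rpow_le_rpow_of_exponent_le hN1 (by linarith)
  have h8 : (N : ℝ)⁻¹ ≤ C₂ * (N : ℝ) ^ (-(δ / 16)) := (h₂ N hN).trans (by
    gcongr
    linarith)
  rw [h4, ← add_sub_cancel_right (∑ g ∈ univ.filter (fun g : β → Fin M => Function.Injective g),
        closedSum N c (fun v => ω (g v))), h5]
  refine (norm_sub_le _ _).trans ((add_le_add h3 h6).trans ?_)
  calc _ ≤ C₁ * (N ^ (n + 2) * (N : ℝ) ^ (-(δ / 16))) +
        (n + 1) ^ 2 * (1 + ρ) ^ n * (N ^ (n + 2) * (C₂ * (N : ℝ) ^ (-(δ / 16)))) := by gcongr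
    _ = _ := by ring

end ClosedSums

/-! ### The trace as a sum over closed paths. -/

section Trace

open Matrix

/-- `H²` is block diagonal with blocks `X X*` and `X* X`, whose positive powers have equal traces.
For `k = 0` the two sides would be `M + N` and `2 M`. -/
theorem trace_skewShiftH_pow {M : ℕ} (N k : ℕ) (ω x y : Fin M → UnitAddCircle) (hk : 1 ≤ k) :
    trace (skewShiftH N ω x y ^ (2 * k)) =
      2 * trace ((skewShiftX N ω x y * (skewShiftX N ω x y)ᴴ) ^ k) := by
  set X := skewShiftX N ω x y with hX
  have h1 : skewShiftH N ω x y ^ 2 = fromBlocks (X * Xᴴ) 0 0 (Xᴴ * X) := by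
    rw [skewShiftH, ← hX, sq, fromBlocks_multiply]
    simp
  have h2 : ∀ n : ℕ, (Xᴴ * X) ^ (n + 1) = Xᴴ * ((X * Xᴴ) ^ n * X) := by
    intro n
    induction n with
    | zero => simp
    | succ n ih =>
      rw [pow_succ, ih, pow_succ (X * Xᴴ)]
      simp only [Matrix.mul_assoc]
  obtain ⟨n, rfl⟩ := Nat.exists_eq_add_of_le' hk
  rw [pow_mul, h1, fromBlocks_diagonal_pow, h2]
  have h3 : ∀ (A : Matrix (Fin M) (Fin M) ℂ) (D : Matrix (Fin N) (Fin N) ℂ),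
      trace (fromBlocks A 0 0 D) = trace A + trace D := fun A D => by
    simp [trace, Fintype.sum_sum_type]
  rw [h3, trace_mul_comm Xᴴ, Matrix.mul_assoc, ← pow_succ, two_mul]

theorem matrix_pow_apply {M : ℕ} {R : Type*} [CommSemiring R] (A : Matrix (Fin M) (Fin M) R)
    (n : ℕ) (a b : Fin M) :
    (A ^ n) a b = ∑ c : Fin (n + 1) → Fin M, if c 0 = a ∧ c (Fin.last n) = b then
      ∏ l : Fin n, A (c l.castSucc) (c l.succ) else 0 := by
  induction n generalizing a with
  | zero =>
    rw [pow_zero, Matrix.one_apply, ← (Equiv.funUnique (Fin 1) (Fin M)).symm.sum_comp]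
    have : ∀ x : Fin M, (if x = a ∧ x = b then (1 : R) else 0) =
        if x = a then (if a = b then 1 else 0) else 0 := by
      intro x
      split_ifs <;> simp_all
    simp [this]
  | succ n ih =>
    rw [← (Fin.consEquiv (fun _ => Fin M)).sum_comp, Fintype.sum_prod_type_right, pow_succ',
      Matrix.mul_apply]
    simp only [ih, mul_sum]
    rw [sum_comm]
    refine sum_congr rfl fun c _ => ?_
    have h1 : ∀ x : Fin M, A a x * (if c 0 = x ∧ c (Fin.last n) = b then
        ∏ l : Fin n, A (c l.castSucc) (c l.succ) else 0) = if c 0 = x then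
        (if c (Fin.last n) = b then A a x * ∏ l : Fin n, A (c l.castSucc) (c l.succ) else 0)
        else 0 := by
      intro x
      split_ifs <;> simp_all
    have h2 : ∀ x : Fin M, (if (Fin.consEquiv fun _ => Fin M) (x, c) 0 = a ∧
        (Fin.consEquiv fun _ => Fin M) (x, c) (Fin.last (n + 1)) = b then
        ∏ l : Fin (n + 1), A ((Fin.consEquiv fun _ => Fin M) (x, c) l.castSucc)
          ((Fin.consEquiv fun _ => Fin M) (x, c) l.succ) else 0) = if x = a then
        (if c (Fin.last n) = b then A a (c 0) * ∏ l : Fin n, A (c l.castSucc) (c l.succ) else 0)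
        else 0 := by
      intro x
      simp only [Fin.consEquiv, Equiv.coe_fn_mk, Fin.prod_univ_succ, ← Fin.succ_last,
        Fin.cons_succ, Fin.cons_zero, Fin.castSucc_zero, ← Fin.succ_castSucc]
      split_ifs <;> simp_all
    simp only [h1, h2, sum_ite_eq, sum_ite_eq', mem_univ, if_true]

/-- The closing edge is kept apart from the others; its column index becomes the value `f` in
`closedSum`. -/
theorem trace_pow_succ {M : ℕ} {R : Type*} [CommSemiring R] (A : Matrix (Fin M) (Fin M) R)
    (n : ℕ) :
    trace (A ^ (n + 1)) = ∑ c : Fin (n + 1) → Fin M,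
      A (c (Fin.last n)) (c 0) * ∏ l : Fin n, A (c l.castSucc) (c l.succ) := by
  simp only [trace, Matrix.diag_apply, pow_succ, Matrix.mul_apply, matrix_pow_apply, sum_mul]
  rw [← sum_comm_three]
  refine sum_congr rfl fun c _ => ?_
  have h : ∀ x y : Fin M, (if c 0 = x ∧ c (Fin.last n) = y then
      ∏ l : Fin n, A (c l.castSucc) (c l.succ) else 0) * A y x = if c 0 = x then
      (if c (Fin.last n) = y then A y x * ∏ l : Fin n, A (c l.castSucc) (c l.succ) else 0)
      else 0 := by
    intro x y
    split_ifs <;> simp_all [mul_comm]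
  simp only [h]
  rw [sum_comm]
  simp

theorem expTorus_add (s t : UnitAddCircle) : expTorus (s + t) = expTorus s * expTorus t := by
  rw [expTorus, AddCircle.toCircle_add]
  rfl

theorem conj_expTorus (t : UnitAddCircle) : (starRingEnd ℂ) (expTorus t) = expTorus (-t) := by
  rw [expTorus, expTorus, AddCircle.toCircle_neg, Circle.coe_inv_eq_conj]

theorem prod_expTorus {ι : Type*} (s : Finset ι) (f : ι → UnitAddCircle) :
    ∏ i ∈ s, expTorus (f i) = expTorus (∑ i ∈ s, f i) := by
  classical
  induction s using Finset.induction_on with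
  | empty => simp [expTorus]
  | insert a s ha ih => rw [sum_insert ha, prod_insert ha, expTorus_add, ih]

/-- The exponent of the product of the entry with indices `a, z` of `X` and the conjugate of the
entry with indices `b, z`, with the phases omitted. -/
noncomputable def pairPhase {M : ℕ} (ω : ℕ → ℝ) (y : Fin M → ℝ) (z : ℤ) (a b : Fin M) : ℝ :=
  tri z * (ω a - ω b) + z * (y a - y b)

theorem skewShiftX_mul_conj {M N : ℕ} (ω : ℕ → ℝ) (x : ℕ → UnitAddCircle) (y : Fin M → ℝ)
    (a b : Fin M) (f : Fin N) :
    skewShiftX N (fun i : Fin M => (ω i : UnitAddCircle)) (fun i => x i)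
        (fun i => (y i : UnitAddCircle)) a f *
      (starRingEnd ℂ) (skewShiftX N (fun i : Fin M => (ω i : UnitAddCircle)) (fun i => x i)
        (fun i => (y i : UnitAddCircle)) b f) =
      (N : ℂ)⁻¹ * expTorus ((pairPhase ω y ((f : ℤ) + 1) a b : ℝ) + (x a - x b)) := by
  have hN : (((Real.sqrt N)⁻¹ : ℝ) : ℂ) * (((Real.sqrt N)⁻¹ : ℝ) : ℂ) = (N : ℂ)⁻¹ := by
    rw [← Complex.ofReal_mul, ← mul_inv, Real.mul_self_sqrt (by positivity)]
    push_cast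
    rfl
  have hc : tri ((f : ℤ) + 1) = ((((f : ℕ) + 1).choose 2 : ℕ) : ℝ) := by
    rw [Nat.cast_choose_two, tri]
    push_cast
    ring
  have hp : pairPhase ω y ((f : ℤ) + 1) a b = ((f : ℕ) + 1).choose 2 • ω a -
      ((f : ℕ) + 1).choose 2 • ω b + (((f : ℕ) + 1) • y a - ((f : ℕ) + 1) • y b) := by
    rw [pairPhase, hc]
    simp only [nsmul_eq_mul]
    push_cast
    ring
  simp only [skewShiftX, skewShift_iterate, map_mul, Complex.conj_ofReal, conj_expTorus]
  rw [mul_mul_mul_comm, hN, ← expTorus_add, hp, AddCircle.coe_add, AddCircle.coe_sub,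
    AddCircle.coe_sub, AddCircle.coe_nsmul, AddCircle.coe_nsmul, AddCircle.coe_nsmul,
    AddCircle.coe_nsmul]
  congr 2
  abel

theorem sum_castSucc_sub_succ {G : Type*} [AddCommGroup G] {n : ℕ} (F : Fin (n + 1) → G) :
    ∑ l : Fin n, (F l.castSucc - F l.succ) = F 0 - F (Fin.last n) := by
  have h := Fin.sum_univ_succ F
  rw [Fin.sum_univ_castSucc] at h
  rw [sum_sub_distrib, sub_eq_sub_iff_add_eq_add, h, add_comm]

theorem sum_mul_ite_sub_ite {β : Type*} [Fintype β] [DecidableEq β] (θ : β → ℝ) (a b : β) :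
    ∑ v, θ v * ((if a = v then 1 else 0) - (if b = v then 1 else 0)) = θ a - θ b := by
  simp [mul_sub, sum_sub_distrib]

/-- Summation by parts: matrix entries give phases edge by edge, while frequencies and `y` have to
be collected label by label. -/
theorem sum_mul_pathDiv {β : Type} [Fintype β] [DecidableEq β] {n : ℕ} (c : Fin (n + 1) → β)
    (θ : β → ℝ) (a : Fin n → ℝ) (r : ℝ) :
    ∑ v, θ v * (pathDiv c a v - endDiv c r v) = r * (θ (c (Fin.last n)) - θ (c 0)) +
      ∑ l, a l * (θ (c l.castSucc) - θ (c l.succ)) := by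
  have h1 : ∑ v, θ v * pathDiv c a v = ∑ l, a l * (θ (c l.castSucc) - θ (c l.succ)) := by
    simp only [pathDiv, mul_sum]
    rw [sum_comm]
    refine sum_congr rfl fun l _ => ?_
    rw [← sum_mul_ite_sub_ite, mul_sum]
    exact sum_congr rfl fun v _ => mul_left_comm _ _ _
  have h2 : ∑ v, θ v * endDiv c r v = r * (θ (c 0) - θ (c (Fin.last n))) := by
    rw [← sum_mul_ite_sub_ite, mul_sum]
    exact sum_congr rfl fun v _ => mul_left_comm _ _ _
  simp only [mul_sub (θ _), sum_sub_distrib]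
  rw [h1, h2]
  ring

theorem intCast_pathDiv_sub_endDiv {β : Type} [DecidableEq β] {n : ℕ} (c : Fin (n + 1) → β)
    (j : Fin n → ℤ) (f : ℤ) (v : β) : ((pathDiv c j v - endDiv c f v : ℤ) : ℝ) =
      pathDiv c (fun l => (j l : ℝ)) v - endDiv c (f : ℝ) v := by
  simp only [pathDiv, endDiv]
  push_cast
  rfl

/-- The trace of the power of `X X^*` as a sum over closed paths. -/
theorem trace_skewShiftX_pow {M N : ℕ} (n : ℕ) (ω : ℕ → ℝ) (x : ℕ → UnitAddCircle)
    (y : Fin M → ℝ) :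
    trace ((skewShiftX N (fun i : Fin M => (ω i : UnitAddCircle)) (fun i => x i)
        (fun i => (y i : UnitAddCircle)) *
      (skewShiftX N (fun i : Fin M => (ω i : UnitAddCircle)) (fun i => x i)
        (fun i => (y i : UnitAddCircle)))ᴴ) ^ (n + 1)) =
    ∑ c : Fin (n + 1) → Fin M, ∑ f : Fin N, ∑ j : Fin n → Fin N, ((N : ℂ)⁻¹) ^ (n + 1) *
      (expe (∑ v : Fin M, ω v * (pathDiv c (fun l => tri ((j l : ℤ) + 1)) v - endDiv c (tri (f + 1)) v)) *
        expe (∑ v, y v * ((pathDiv c (fun l => (j l : ℤ) + 1) v -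
          endDiv c ((f : ℤ) + 1) v : ℤ) : ℝ))) := by
  rw [trace_pow_succ]
  refine sum_congr rfl fun c _ => ?_
  simp only [Matrix.mul_apply, conjTranspose_apply, RCLike.star_def, skewShiftX_mul_conj]
  rw [prod_univ_sum, Fintype.piFinset_univ, sum_mul_sum]
  refine sum_congr rfl fun f _ => sum_congr rfl fun j _ => ?_
  rw [prod_mul_distrib, prod_const, card_univ, Fintype.card_fin, prod_expTorus, mul_mul_mul_comm,
    ← pow_succ', ← expTorus_add, ← expe_add]
  congr 1
  rw [← expTorus_coe]
  congr 1
  simp only [intCast_pathDiv_sub_endDiv]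
  rw [sum_mul_pathDiv c (fun v => ω v), sum_mul_pathDiv, sum_add_distrib,
    sum_castSucc_sub_succ fun l => x (c l)]
  -- The phases `x` cancel around the closed path.
  rw [add_add_add_comm, sub_add_sub_cancel, sub_self, add_zero]
  have hcoe : ∑ l : Fin n, ((pairPhase ω y ((j l : ℤ) + 1) (c l.castSucc) (c l.succ) : ℝ) :
      UnitAddCircle) = ((∑ l : Fin n, pairPhase ω y ((j l : ℤ) + 1) (c l.castSucc) (c l.succ) : ℝ) :
      UnitAddCircle) :=
    (map_sum (QuotientAddGroup.mk' (AddSubgroup.zmultiples (1 : ℝ))) _ _).symm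
  rw [hcoe, ← AddCircle.coe_add]
  congr 1
  simp only [pairPhase, sum_add_distrib]
  ring

end Trace

/-! ### Averaging over `y`. -/

section Average

open MeasureTheory

theorem integral_expe_mul_int (m : ℤ) :
    ∫ t in Set.Icc (0 : ℝ) 1, expe (t * m) = if m = 0 then 1 else 0 := by
  split_ifs with h
  · simp [h, expe_zero]
  · rw [integral_Icc_eq_integral_Ioc, ← intervalIntegral.integral_of_le zero_le_one]
    have hm : (2 * Real.pi * Complex.I * m : ℂ) ≠ 0 := by
      simp [Complex.I_ne_zero, Real.pi_ne_zero, h]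
    have e : ∀ t : ℝ, expe (t * m) = Complex.exp (2 * Real.pi * Complex.I * m * t) := by
      intro t
      rw [expe]
      congr 1
      push_cast
      ring
    simp only [e]
    rw [integral_exp_mul_complex hm]
    have h1 : Complex.exp (2 * Real.pi * Complex.I * m * (1 : ℝ)) = 1 := by
      rw [← Complex.exp_int_mul_two_pi_mul_I m]
      congr 1
      push_cast
      ring
    rw [h1]
    simp

theorem continuous_expe : Continuous expe := by
  unfold expe
  fun_prop

theorem integral_expe_sum_mul_int {M : ℕ} (m : Fin M → ℤ) :
    ∫ y in Set.Icc (0 : Fin M → ℝ) 1, expe (∑ v, y v * (m v : ℝ)) = if m = 0 then 1 else 0 := by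
  have h1 : Set.Icc (0 : Fin M → ℝ) 1 = Set.univ.pi fun _ => Set.Icc (0 : ℝ) 1 := by
    rw [Set.pi_univ_Icc]
    rfl
  simp only [expe_sum]
  rw [h1, volume_pi, Measure.restrict_pi_pi,
    integral_fintype_prod_eq_prod (fun v (t : ℝ) => expe (t * (m v : ℝ)))]
  simp only [integral_expe_mul_int]
  split_ifs with h
  · exact prod_eq_one fun v _ => if_pos (congrFun h v)
  · obtain ⟨v, hv⟩ := Function.ne_iff.1 h
    exact prod_eq_zero (mem_univ v) (if_neg hv)

theorem sum_Icc_eq_sum_fin (N : ℕ) (G : ℤ → ℂ) :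
    ∑ f ∈ Icc (1 : ℤ) N, G f = ∑ f : Fin N, G ((f : ℤ) + 1) := by
  symm
  refine sum_bij (fun f _ => (f : ℤ) + 1) ?_ ?_ ?_ fun _ _ => rfl
  · intro f _
    have := f.2
    rw [mem_Icc]
    omega
  · intro f _ f' _ h
    ext
    omega
  · intro z hz
    rw [mem_Icc] at hz
    exact ⟨⟨(z - 1).toNat, by omega⟩, mem_univ _, by simp; omega⟩

theorem sum_boxFlows_eq_sum_fin {β : Type*} [DecidableEq β] {n : ℕ} (N : ℕ) (c : Fin (n + 1) → β)
    (d : β → ℤ) (G : (Fin n → ℤ) → ℂ) [∀ j : Fin n → Fin N,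
      Decidable (pathDiv c (fun l => (j l : ℤ) + 1) = d)] :
    ∑ j ∈ boxFlows (Icc (1 : ℤ) N) c d, G j = ∑ j : Fin n → Fin N,
      if pathDiv c (fun l => (j l : ℤ) + 1) = d then G (fun l => (j l : ℤ) + 1) else 0 := by
  rw [← sum_filter]
  symm
  refine sum_bij (fun j _ l => (j l : ℤ) + 1) ?_ ?_ ?_ fun _ _ => rfl
  · intro j hj
    rw [mem_boxFlows]
    refine ⟨fun l => ?_, (mem_filter.1 hj).2⟩
    have := (j l).2
    rw [mem_Icc]
    omega
  · intro j _ j' _ h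
    funext l
    have := congrFun h l
    ext
    omega
  · intro z hz
    rw [mem_boxFlows] at hz
    have hz1 : ∀ l, 1 ≤ z l ∧ z l ≤ N := fun l => mem_Icc.1 (hz.1 l)
    have hzz : (fun l => (((z l - 1).toNat : ℕ) : ℤ) + 1) = z := by
      funext l
      have := hz1 l
      omega
    refine ⟨fun l => ⟨(z l - 1).toNat, by have := hz1 l; omega⟩, ?_, hzz⟩
    simp only [mem_filter, mem_univ, true_and]
    rw [hzz]
    exact hz.2

/-- The averaged moments as a sum over closed paths. -/
theorem averagedEvenMoment_eq (M N n : ℕ) (ω : ℕ → ℝ) (x : ℕ → UnitAddCircle) :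
    averagedEvenMoment M N (n + 1) ω x =
      ((N : ℂ)⁻¹) ^ (n + 2) * ∑ c : Fin (n + 1) → Fin M, closedSum N c fun v => ω v := by
  simp only [averagedEvenMoment, averageY, evenMoment]
  rw [integral_const_mul]
  simp only [trace_skewShiftH_pow N (n + 1) _ _ _ (Nat.succ_pos n), trace_skewShiftX_pow]
  rw [integral_const_mul]
  have hint : ∀ (m : Fin M → ℤ) (a b : ℂ), IntegrableOn
      (fun y : Fin M → ℝ => a * (b * expe (∑ v, y v * (m v : ℝ)))) (Set.Icc 0 1) := by
    intro m a b
    refine Continuous.integrableOn_Icc ?_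
    have := continuous_expe
    fun_prop
  rw [integral_finsetSum _ fun c _ => integrable_finsetSum _ fun f _ =>
    integrable_finsetSum _ fun j _ => hint _ _ _]
  rw [← mul_assoc, mul_sum, mul_sum]
  refine sum_congr rfl fun c _ => ?_
  rw [integral_finsetSum _ fun f _ => integrable_finsetSum _ fun j _ => hint _ _ _, closedSum,
    sum_Icc_eq_sum_fin, mul_sum, mul_sum]
  refine sum_congr rfl fun f _ => ?_
  classical
  rw [integral_finsetSum _ fun j _ => hint _ _ _, sum_boxFlows_eq_sum_fin, mul_sum, mul_sum]
  refine sum_congr rfl fun j _ => ?_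
  -- Orthogonality of characters keeps exactly the flows that the edge carrying `f + 1` closes up to
  -- a circulation.
  rw [integral_const_mul, integral_const_mul, integral_expe_sum_mul_int]
  have hiff : ((fun v => pathDiv c (fun l => (j l : ℤ) + 1) v - endDiv c ((f : ℤ) + 1) v) = 0) ↔
      pathDiv c (fun l => (j l : ℤ) + 1) = endDiv c ((f : ℤ) + 1) :=
    sub_eq_zero (a := pathDiv c fun l => (j l : ℤ) + 1) (b := endDiv c ((f : ℤ) + 1))
  simp only [hiff]
  split_ifs
  · rw [mul_one, pow_succ _ (n + 1)]
    ring
  · simp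

end Average

/-! ### Grouping words by partitions, and the conclusion. -/

open Classical in
/-- A sum over all labelings, grouped by the partition into the sets of equal labels. -/
theorem sum_eq_sum_setoid {α β : Type} [Fintype α] [DecidableEq α]
    [Fintype β] [Fintype (Setoid α)] (H : (α → β) → ℂ) :
    ∑ c : α → β, H c = ∑ π : Setoid α, ∑ g : Quotient π ↪ β, H (g ∘ Quotient.mk π) := by
  rw [← sum_fiberwise univ (fun c : α → β => Setoid.ker c)]
  refine sum_congr rfl fun π _ => ?_
  symm
  refine sum_bij (fun g _ => g ∘ Quotient.mk π) ?_ ?_ ?_ fun _ _ => rfl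
  · intro g _
    simp only [mem_filter, mem_univ, true_and]
    ext a b
    simp only [Setoid.ker_def, Function.comp_apply, g.injective.eq_iff]
    exact Quotient.eq
  · intro g _ g' _ h
    ext q
    induction q using Quotient.inductionOn with
    | h a => exact congrFun h a
  · intro c hc
    obtain rfl : Setoid.ker c = π := by simpa using hc
    exact ⟨⟨Setoid.kerLift c, Setoid.kerLift_injective c⟩, mem_univ _, rfl⟩

open Classical in
/-- The sum over all noncrossing words. -/
theorem sum_closedSum_noncrossing (M N n : ℕ) (hN : 1 ≤ N) (θ : Fin M → ℝ) :
    ((N : ℂ)⁻¹) ^ (n + 2) * (∑ c : Fin (n + 1) → Fin M,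
      if NoncrossingWord (List.ofFn c) then closedSum N c θ else 0) =
      (noncrossingSum M N (n + 1) fun _ => 1 : ℝ) := by
  have hN0 : (N : ℂ) ≠ 0 := by exact_mod_cast (by omega : N ≠ 0)
  rw [noncrossingSum, Complex.ofReal_sum, mul_sum]
  refine sum_congr rfl fun c _ => ?_
  by_cases hc : NoncrossingWord (List.ofFn c)
  · rw [if_pos hc, if_pos hc]
    have h := closedSum_of_noncrossing N c θ hc
    push_cast
    rw [mul_one, inv_pow, inv_pow, inv_mul_eq_iff_eq_mul₀ (pow_ne_zero _ hN0),
      eq_mul_inv_iff_mul_eq₀ (pow_ne_zero _ hN0), h]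
  · rw [if_neg hc, if_neg hc]
    simp

open Classical in
/-- The sum over all crossing words. -/
theorem QuasiRandom.exists_norm_sum_crossing_le {δ ρ : ℝ} {ω : ℕ → ℝ} (hω : QuasiRandom δ ρ ω)
    (hρ : 0 < ρ) (hδ : 0 < δ) (n : ℕ) :
    ∃ C : ℝ, 0 < C ∧ ∀ N : ℕ, 1 ≤ N →
      ‖∑ c : Fin (n + 1) → Fin ⌊ρ * N⌋₊,
        if NoncrossingWord (List.ofFn c) then 0 else closedSum N c fun v => ω v‖ ≤
        C * (N ^ (n + 2) * (N : ℝ) ^ (-(δ / 16))) := by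
  obtain ⟨C, hC, h⟩ := hω.exists_norm_sum_embedding_closedSum_le hρ hδ n
  have : Finite (Setoid (Fin (n + 1))) :=
    Finite.of_injective (fun π : Setoid (Fin (n + 1)) => (fun a b => π.r a b))
      fun π π' h => Setoid.ext fun a b => iff_of_eq (congrFun (congrFun h a) b)
  have : Fintype (Setoid (Fin (n + 1))) := Fintype.ofFinite _
  refine ⟨Fintype.card (Setoid (Fin (n + 1))) * C,
    mul_pos (by exact_mod_cast Fintype.card_pos) hC, fun N hN => ?_⟩
  rw [sum_eq_sum_setoid, mul_assoc, ← nsmul_eq_mul, ← card_univ, ← sum_const]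
  refine (norm_sum_le _ _).trans (sum_le_sum fun π _ => ?_)
  -- Being noncrossing depends only on the partition, and the number of partitions depends only on
  -- `n`.
  have hword : ∀ g : Quotient π ↪ Fin ⌊ρ * N⌋₊,
      NoncrossingWord (List.ofFn (g ∘ Quotient.mk π)) ↔
        NoncrossingWord (List.ofFn (Quotient.mk π)) := fun g => by
    rw [← List.map_ofFn, noncrossingWord_map g g.injective]
  simp only [hword]
  by_cases hπ : NoncrossingWord (List.ofFn (Quotient.mk π))
  · simp only [if_pos hπ, sum_const_zero, norm_zero]
    positivity
  · simp only [if_neg hπ, closedSum_comp N _ (Function.Embedding.injective _)]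
    exact h N hN (Quotient.mk π) Quotient.mk_surjective hπ

theorem theorem2 (ρ δ : ℝ) (hρ : 0 < ρ) (hδ : 0 < δ) (ω : ℕ → ℝ) (hω : QuasiRandom δ ρ ω)
    (k : ℕ) (hk : 1 ≤ k) :
    ∃ C : ℝ, ∀ x : ℕ → UnitAddCircle, ∀ N : ℕ, 1 ≤ N →
      ‖averagedEvenMoment ⌊ρ * N⌋₊ N k ω x - (rescaledMPMoment ρ k : ℂ)‖ ≤
        C * (N : ℝ) ^ (-(δ / 16)) := by
  classical
  obtain ⟨n, rfl⟩ := Nat.exists_eq_add_of_le' hk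
  obtain ⟨C₁, hC₁, h₁⟩ := hω.exists_norm_sum_crossing_le hρ hδ n
  obtain ⟨C₂, h₂⟩ := noncrossingSum_asymptotics ρ hρ (n + 1) fun _ => 1
  obtain ⟨C₃, hC₃, h₃⟩ := hω.exists_inv_le hρ hδ
  refine ⟨|C₂| * C₃ + C₁, fun x N hN => ?_⟩
  have hN1 : (1 : ℝ) ≤ N := by exact_mod_cast hN
  have hN0 : (0 : ℝ) < N := by linarith
  have hinv : (N : ℝ)⁻¹ ≤ C₃ * (N : ℝ) ^ (-(δ / 16)) := (h₃ N hN).trans (by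
    gcongr
    linarith)
  have hsplit : ∑ c : Fin (n + 1) → Fin ⌊ρ * N⌋₊, closedSum N c (fun v => ω v) =
      (∑ c : Fin (n + 1) → Fin ⌊ρ * N⌋₊,
        if NoncrossingWord (List.ofFn c) then closedSum N c (fun v => ω v) else 0) +
      ∑ c : Fin (n + 1) → Fin ⌊ρ * N⌋₊,
        if NoncrossingWord (List.ofFn c) then 0 else closedSum N c (fun v => ω v) := by
    rw [← sum_add_distrib]
    refine sum_congr rfl fun c _ => ?_
    split_ifs <;> simp
  have hmain := h₂ N hN
  rw [transfer_iterate_one_zero ρ hρ] at hmain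
  rw [averagedEvenMoment_eq, hsplit, mul_add, sum_closedSum_noncrossing _ N n hN,
    add_sub_right_comm, ← Complex.ofReal_sub, add_mul]
  refine (norm_add_le _ _).trans (add_le_add ?_ ?_)
  · rw [Complex.norm_real, Real.norm_eq_abs]
    calc _ ≤ C₂ / N := hmain
      _ ≤ |C₂| * (N : ℝ)⁻¹ := by
        rw [div_eq_mul_inv]
        gcongr
        exact le_abs_self C₂
      _ ≤ |C₂| * (C₃ * (N : ℝ) ^ (-(δ / 16))) := by gcongr
      _ = _ := by ring
  · rw [norm_mul, norm_pow, norm_inv, Complex.norm_natCast]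
    calc _ ≤ ((N : ℝ)⁻¹) ^ (n + 2) * (C₁ * (N ^ (n + 2) * (N : ℝ) ^ (-(δ / 16)))) := by
          gcongr
          exact h₁ N hN
      _ = (((N : ℝ)⁻¹ * N) ^ (n + 2)) * (C₁ * (N : ℝ) ^ (-(δ / 16))) := by ring
      _ = _ := by rw [inv_mul_cancel₀ hN0.ne', one_pow, one_mul]
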